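/- Let $T>0$, $H\in(\tfrac12,1)$ and $a,b\in\mathbb R$ with $ab\neq 0$. Write $L^2=L^2([0,T])$, $\mathbf 1_t=\mathbf 1_{[0,t)}$, $$c(H)=\sqrt{\frac{2H\,\Gamma(\frac32-H)}{\Gamma(H+\frac12)\Gamma(2-2H)}}\,\Bigl(H-\tfrac12\Bigr),\qquad K_H(t,s)=\frac{c(H)}{s^{H-\frac12}}\int_s^t\frac{u^{H-\frac12}}{(u-s)^{\frac32-H}}\,du\quad(s<t),$$ and $K_H(t,s)=0$ for $s\ge t$. For a square-integrable process $Y=(Y_t)_{t\in[0,T]}$ with $R_Y(t,s)=\mathbb E[Y_tY_s]$, let $\Lambda_Y$ be the completion of the linear span of the indicators $\mathbf 1_t$, $t\in[0,T]$, under the inner product generated by $\langle\mathbf 1_t,\mathbf 1_s\rangle=R_Y(t,s)$; the abstract Wiener integral $f\mapsto\int_0^Tf\,dY$ is the isometry from $\Lambda_Y$ into $L^2(\Omega)$ that extends $\mathbf 1_t\mapsto Y_t$. We say $\Lambda_Y=L^2$ if $\mathbf 1_t\mapsto\mathbf 1_t$ extends to an isomorphism of topological vector spaces $\Lambda_Y\to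 L^2$; then $\int_0^Tf\,dY$ is defined for every $f\in L^2$. Let $W$ be a standard Brownian motion on $[0,T]$ and let $X$ be the completely correlated mixed fractional Brownian motion $X_t=aW_t+b\int_0^TK_H(t,s)\,dW_s$ (a.s. for each $t\in[0,T]$). Put $L(t,s)=a\mathbf 1_t(s)+bK_H(t,s)$ and $$L^{-1}(t,s)=\frac1a\mathbf 1_t(s)+\frac1a\sum_{k=1}^\infty(-1)^k\Bigl(\frac ba\Bigr)^k\gamma_k(t,s),$$ $$\gamma_k(t,s)=\frac{c(H)^k\,\Gamma(H-\frac12)^k}{\Gamma(k(H-\frac12))}\,\frac1{s^{H-\frac12}}\int_s^tu^{H-\frac12}(u-s)^{k(H-\frac12)-1}\,du\quad(s<t),\qquad\gamma_k(t,s)=0\quad(s\ge t).$$ Then $\Lambda_W=L^2$ and $\Lambda_X=L^2$; for all $t\in[0,T]$ and $0<s\le T$ the series for $L^{-1}(t,s)$ converges absolutely, and $t\mapsto L^{-1}(t,s)$ is of bounded variation on $[0,T]$. There is a bounded linear operator $\mathrm L^*$ on $L^2$ with bounded inverse such that $\mathrm L^*\mathbf 1_t=L(t,\cdot)$ and $(\mathrm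 L^*)^{-1}\mathbf 1_t=L^{-1}(t,\cdot)$ for all $t\in[0,T]$, and for every $f\in L^2$, for almost every $t\in[0,T]$, $$\mathrm L^*f(t)=af(t)+b\int_t^Tf(s)\,\frac{\partial K_H}{\partial s}(s,t)\,ds,$$ $$(\mathrm L^*)^{-1}f(t)=f(t)L^{-1}(T,t)+\int_t^T[f(s)-f(t)]\,L^{-1}(ds,t),$$ where both integrals converge absolutely for almost every $t$, the second being the Lebesgue--Stieltjes integral with respect to $s\mapsto L^{-1}(s,t)$. Moreover, for every $f\in L^2$, almost surely, $$\int_0^Tf(t)\,dX_t=\int_0^T\mathrm L^*f(t)\,dW_t,\qquad\int_0^Tf(t)\,dW_t=\int_0^T(\mathrm L^*)^{-1}f(t)\,dX_t.$$ -/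

import Mathlib

open MeasureTheory ProbabilityTheory Set
open scoped ENNReal

noncomputable section

namespace CCMFBm

/-! ### Square-integrable processes on `[0, T]`, integrand space and abstract Wiener integral -/

/-- Lebesgue measure on `[0, T]`. -/
abbrev leb (T : ℝ) : Measure ℝ := volume.restrict (Icc 0 T)

/-- The real Hilbert space `L²[0, T]`. -/
abbrev L2 (T : ℝ) : Type := Lp ℝ 2 (leb T)

/-- The indicator function `1_t = 1_{[0,t)}`. -/
def ind (t s : ℝ) : ℝ := (Ico 0 t).indicator (fun _ => (1 : ℝ)) s

/-- The class of `1_t` in `L²[0, T]`. -/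
def indL2 (T t : ℝ) : L2 T :=
  indicatorConstLp 2 (measurableSet_Ico (a := (0 : ℝ)) (b := t))
    (((Measure.restrict_apply_le _ _).trans_lt measure_Ico_lt_top).ne) (1 : ℝ)

variable {Ω : Type*} [MeasurableSpace Ω]

/-- A real stochastic process indexed by `[0, T]` with square-integrable marginals. -/
structure SquareIntegrableProcess (P : Measure Ω) (T : ℝ) where
  toFun : Icc (0 : ℝ) T → Ω → ℝ
  memLp : ∀ t, MemLp (toFun t) 2 P

variable {P : Measure Ω} {T : ℝ}

instance : CoeFun (SquareIntegrableProcess P T) (fun _ => Icc (0 : ℝ) T → Ω → ℝ) where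
  coe Y := Y.toFun

/-- The class of `Y_t` in `L²(Ω)`. -/
def SquareIntegrableProcess.toL2 (Y : SquareIntegrableProcess P T) (t : Icc (0 : ℝ) T) :
    Lp ℝ 2 P :=
  (Y.memLp t).toLp (Y t)

/-- The function `R(t,s) = E[Y_t Y_s]`, which is the covariance function when `Y` is centered. -/
def covFun (Y : SquareIntegrableProcess P T) (t s : Icc (0 : ℝ) T) : ℝ :=
  ∫ ω, Y t ω * Y s ω ∂P

/-- Formal linear combinations `∑ c_t 1_t` of the indicator functions `1_t`, `t ∈ [0, T]`.
The process `Y` is a parameter because the inner product depends on it. -/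
def StepFn (_Y : SquareIntegrableProcess P T) : Type := Icc (0 : ℝ) T →₀ ℝ

instance (Y : SquareIntegrableProcess P T) : AddCommGroup (StepFn Y) :=
  inferInstanceAs (AddCommGroup (Icc (0 : ℝ) T →₀ ℝ))

instance (Y : SquareIntegrableProcess P T) : Module ℝ (StepFn Y) :=
  inferInstanceAs (Module ℝ (Icc (0 : ℝ) T →₀ ℝ))

/-- `1_t` as a formal linear combination. -/
def stepInd (Y : SquareIntegrableProcess P T) (t : Icc (0 : ℝ) T) : StepFn Y :=
  Finsupp.single t (1 : ℝ)

/-- The linear map `∑ c_t 1_t ↦ ∑ c_t Y_t`. -/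
def stepMap (Y : SquareIntegrableProcess P T) : StepFn Y →ₗ[ℝ] Lp ℝ 2 P :=
  Finsupp.linearCombination ℝ Y.toL2

/-- The bilinear form generated by `⟨1_t, 1_s⟩ = R(t,s)`. -/
def stepInner (Y : SquareIntegrableProcess P T) (c d : StepFn Y) : ℝ :=
  Finsupp.sum c fun t x => Finsupp.sum d fun s y => x * y * covFun Y t s

theorem inner_toL2 (Y : SquareIntegrableProcess P T) (t s : Icc (0 : ℝ) T) :
    inner ℝ (Y.toL2 t) (Y.toL2 s) = covFun Y t s := by
  rw [L2.inner_def]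
  refine integral_congr_ae ?_
  filter_upwards [(Y.memLp t).coeFn_toLp, (Y.memLp s).coeFn_toLp] with ω h1 h2
  simp only [SquareIntegrableProcess.toL2, h1, h2]
  simp [mul_comm]

theorem stepInner_eq (Y : SquareIntegrableProcess P T) (c d : StepFn Y) :
    stepInner Y c d = inner ℝ (stepMap Y c) (stepMap Y d) := by
  have h : ∀ e : StepFn Y, stepMap Y e = Finsupp.sum e fun t x => x • Y.toL2 t :=
    fun e => Finsupp.linearCombination_apply ℝ e
  simp only [stepInner, h, Finsupp.sum, sum_inner, inner_sum, inner_smul_left, inner_smul_right,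
    inner_toL2, Finset.mul_sum, RCLike.conj_to_real]
  rw [Finset.sum_comm]
  exact Finset.sum_congr rfl fun _ _ => Finset.sum_congr rfl fun _ _ => by ring

/-- The (semi-definite) inner product on step functions. -/
@[reducible]
def stepCore (Y : SquareIntegrableProcess P T) : PreInnerProductSpace.Core ℝ (StepFn Y) where
  inner := stepInner Y
  conj_inner_symm c d := by
    simp only [stepInner_eq]
    exact inner_conj_symm _ _
  re_inner_nonneg c := by
    simp only [stepInner_eq]
    exact inner_self_nonneg
  add_left c d e := by
    simp only [stepInner_eq, map_add, inner_add_left]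
  smul_left c d r := by
    simp only [stepInner_eq, map_smul, inner_smul_left]

instance (Y : SquareIntegrableProcess P T) : SeminormedAddCommGroup (StepFn Y) :=
  @InnerProductSpace.Core.toSeminormedAddCommGroup ℝ (StepFn Y) _ _ _ (stepCore Y)

instance (Y : SquareIntegrableProcess P T) : InnerProductSpace ℝ (StepFn Y) :=
  InnerProductSpace.ofCore (stepCore Y)

/-- The integrand space `Λ` of `Y`: the closure (completion) of the span of the indicator
functions `1_t` under the inner product generated by `⟨1_t, 1_s⟩ = R(t,s)`. -/
abbrev Lam (Y : SquareIntegrableProcess P T) : Type := UniformSpace.Completion (StepFn Y)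

/-- `1_t` as an element of `Λ`. -/
def indLam (Y : SquareIntegrableProcess P T) (t : Icc (0 : ℝ) T) : Lam Y :=
  (stepInd Y t : Lam Y)

/-- The isometry `∑ c_t 1_t ↦ ∑ c_t Y_t` on step functions. -/
def stepIsometry (Y : SquareIntegrableProcess P T) : StepFn Y →ₗᵢ[ℝ] Lp ℝ 2 P where
  toLinearMap := stepMap Y
  norm_map' c := by
    have h : inner ℝ c c = inner ℝ (stepMap Y c) (stepMap Y c) := stepInner_eq Y c c
    rw [real_inner_self_eq_norm_sq, real_inner_self_eq_norm_sq] at h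
    exact ((sq_eq_sq₀ (norm_nonneg _) (norm_nonneg _)).1 h).symm

/-- The isometry from `Λ` into `L²(Ω)` that extends `1_t ↦ Y_t` (its range is the first
chaos of `Y`). -/
def chaosMap (Y : SquareIntegrableProcess P T) : Lam Y → Lp ℝ 2 P :=
  UniformSpace.Completion.extension (stepIsometry Y)

theorem chaosMap_indLam (Y : SquareIntegrableProcess P T) (t : Icc (0 : ℝ) T) :
    chaosMap Y (indLam Y t) = Y.toL2 t := by
  rw [chaosMap, indLam,
    UniformSpace.Completion.extension_coe (stepIsometry Y).isometry.uniformContinuous]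
  change Finsupp.linearCombination ℝ Y.toL2 (Finsupp.single t 1) = _
  simp

/-- `Λ = L²[0, T]`: the correspondence `1_t ↔ 1_t` extends to an isomorphism of
topological vector spaces between `Λ` and `L²[0, T]` (this isomorphism is unique, the span of
the indicators being dense in `Λ`). -/
def IntegrandSpaceEqL2 (Y : SquareIntegrableProcess P T) : Prop :=
  ∃ e : Lam Y ≃L[ℝ] L2 T, ∀ t : Icc (0 : ℝ) T, e (indLam Y t) = indL2 T t

open Classical in
/-- The abstract Wiener integral `∫_0^T f dY ∈ L²(Ω)` of `f ∈ L²[0, T]` with respect to a process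
`Y` whose integrand space is `L²[0, T]`: the image of `f`, read as an element of `Λ`, under the
isometry that extends `1_t ↦ Y_t`. (Default value `0` if `f ∉ L²[0, T]` or `Λ ≠ L²[0, T]`.) -/
def wienerIntegral (Y : SquareIntegrableProcess P T) (f : ℝ → ℝ) : Lp ℝ 2 P :=
  if h : IntegrandSpaceEqL2 Y ∧ MemLp f 2 (leb T) then
    chaosMap Y (h.1.choose.symm (h.2.toLp f))
  else 0

/-! ### Brownian motion and the completely correlated mixed fractional Brownian motion -/

/-- `W` is a standard Brownian motion on `[0, T]`. -/
structure IsBrownianMotion (W : SquareIntegrableProcess P T) : Prop where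
  gaussian : IsGaussianProcess W.toFun P
  mean : ∀ t, ∫ ω, W t ω ∂P = 0
  cov : ∀ t s, cov[W t, W s; P] = min (t : ℝ) (s : ℝ)
  cont : ∀ᵐ ω ∂P, Continuous fun t => W t ω

/-- The constant `c(H)`. -/
def cH (H : ℝ) : ℝ :=
  Real.sqrt (2 * H * Real.Gamma (3 / 2 - H) / (Real.Gamma (H + 1 / 2) * Real.Gamma (2 - 2 * H)))
    * (H - 1 / 2)

/-- The Molchan--Golosov kernel `K_H(t,s)`, zero unless `s < t`. -/
def KH (H t s : ℝ) : ℝ :=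
  if s < t then
    cH H * (1 / s ^ (H - 1 / 2)) * ∫ u in s..t, u ^ (H - 1 / 2) / (u - s) ^ (3 / 2 - H)
  else 0

/-- `X = a W + b B^H` with `B^H_t = ∫_0^t K_H(t,s) dW_s`, almost surely for each `t`. -/
def IsCCMFBm (a b H : ℝ) (W X : SquareIntegrableProcess P T) : Prop :=
  ∀ t : Icc (0 : ℝ) T,
    X t =ᵐ[P] fun ω => a * W t ω + b * wienerIntegral W (fun s => KH H t s) ω

/-! ### The kernels and operators of the transfer principle -/

/-- The kernel `L(t,s) = a 1_t(s) + b K_H(t,s)`. -/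
def Lker (a b H t s : ℝ) : ℝ := a * ind t s + b * KH H t s

/-- The kernel `γ_k(t,s)`, zero unless `s < t`. -/
def gam (H : ℝ) (k : ℕ) (t s : ℝ) : ℝ :=
  if s < t then
    cH H ^ k * Real.Gamma (H - 1 / 2) ^ k / Real.Gamma (k * (H - 1 / 2)) * (1 / s ^ (H - 1 / 2))
      * ∫ u in s..t, u ^ (H - 1 / 2) * (u - s) ^ (k * (H - 1 / 2) - 1)
  else 0

/-- The `k`-th term of the series in the inverse kernel. -/
def LinvTerm (a b H t s : ℝ) (k : ℕ) : ℝ := (-1) ^ k * (b / a) ^ k * gam H k t s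

/-- The kernel `L⁻¹(t,s) = (1/a) 1_t(s) + (1/a) ∑_{k ≥ 1} (-1)^k (b/a)^k γ_k(t,s)`. -/
def Linv (a b H t s : ℝ) : ℝ :=
  1 / a * ind t s + 1 / a * ∑' k : ℕ, LinvTerm a b H t s (k + 1)

/-- `L^* f(t) = a f(t) + b ∫_t^T f(s) ∂_s K_H(s,t) ds`. -/
def Lstar (a b H T : ℝ) (f : ℝ → ℝ) (t : ℝ) : ℝ :=
  a * f t + b * ∫ s in t..T, f s * deriv (fun u => KH H u t) s

open Classical in
/-- The Lebesgue--Stieltjes signed measure `dg` on `[t, T]` of a function `g` of bounded variation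
on `[t, T]`; here `g` is extended to the real line by `g(t)` on the left of `t` and by `g(T)` on the
right of `T`. (Default value `0` if `g` is not of bounded variation.) -/
def stieltjes (g : ℝ → ℝ) (t T : ℝ) : SignedMeasure ℝ :=
  if h : BoundedVariationOn (fun s => g (max t (min s T))) univ then h.vectorMeasure else 0

/-- `(L^*)⁻¹ f(t) = f(t) L⁻¹(T,t) + ∫_t^T [f(s) - f(t)] L⁻¹(ds,t)`. -/
def LstarInv (a b H T : ℝ) (f : ℝ → ℝ) (t : ℝ) : ℝ :=
  f t * Linv a b H T t
    + (((stieltjes (fun s => Linv a b H s t) t T).restrict (Icc t T)).integral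
        (fun s => f s - f t) (ContinuousLinearMap.lsmul ℝ ℝ))

end CCMFBm

end

noncomputable section

namespace CCMFBm

open scoped NNReal

/-!
With `V` the weighted Volterra operator whose kernel is a multiple of
`(s / t) ^ (H - 1/2) * (s - t) ^ (H - 3/2)` on `t < s`, the operator `L^*` is `a • (id - V)`.
Conjugating by the weight `t ^ (H - 1/2)` turns `V` into convolution with a power, so by the Beta
integral the iterates of `V` are again weighted Volterra operators, with profiles the power
`x ^ (k * (H - 1/2) - 1)` divided by Gamma factors. The Schur test bounds all of them on
`L²[0, T]`, and the Gamma factors make the Neumann series of `(id - V)⁻¹` converge to the operator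
with the summed, Mittag-Leffler type profile; the primitive of its kernel is `L⁻¹`, so the resolvent
formula becomes a Stieltjes integral against `L⁻¹`. Since the covariance of `W` is the Gram matrix
of the indicators, which are total in `L²[0, T]`, the Wiener integral with respect to `W` is an
isometry, and `X_t` is the integral of `L^* 1_t`: both `Λ_X = L²` and the transfer principle follow
by comparing bounded operators on indicators.
-/

/-! ### Integral operators on `L²` -/

section L2Kernel

variable {E : Type*} [MeasurableSpace E] {μ : Measure E}

/-- A jointly measurable kernel on `E × E` whose absolute value defines a bounded integral operator
on `L²(μ)`. The bound is stated for nonnegative extended-valued functions, so that it makes sense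
without any prior integrability. -/
structure IsL2Kernel (μ : Measure E) (K : E → E → ℝ) : Prop where
  measurable : Measurable (Function.uncurry K)
  bound : ∃ C : ℝ≥0, ∀ g : E → ℝ≥0∞, Measurable g →
    ∫⁻ t, (∫⁻ s, ‖K t s‖ₑ * g s ∂μ) ^ 2 ∂μ ≤ C * ∫⁻ s, g s ^ 2 ∂μ

theorem sq_lintegral_mul_le {f g : E → ℝ≥0∞} (hf : AEMeasurable f μ) (hg : AEMeasurable g μ) :
    (∫⁻ s, f s * g s ∂μ) ^ 2 ≤ (∫⁻ s, f s ^ 2 ∂μ) * ∫⁻ s, g s ^ 2 ∂μ := by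
  have holder := ENNReal.lintegral_mul_le_Lp_mul_Lq μ Real.HolderConjugate.two_two hf hg
  have sq_sqrt (x : ℝ≥0∞) : (x ^ (2⁻¹ : ℝ)) ^ 2 = x := by
    rw [← ENNReal.rpow_natCast, ← ENNReal.rpow_mul]
    norm_num
  simpa [mul_pow, sq_sqrt] using pow_le_pow_left₀ zero_le holder 2

theorem sq_lintegral_mul_le_weighted {k w g : E → ℝ≥0∞} (hk : Measurable k) (hw : Measurable w)
    (hg : Measurable g) (hw_pos : ∀ᵐ s ∂μ, w s ≠ 0 ∧ w s ≠ ∞) :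
    (∫⁻ s, k s * g s ∂μ) ^ 2 ≤ (∫⁻ s, k s * w s ∂μ) * ∫⁻ s, k s * (w s)⁻¹ * g s ^ 2 ∂μ := by
  have sq_sqrt (x : ℝ≥0∞) : (x ^ (1 / 2 : ℝ)) ^ 2 = x := by
    rw [← ENNReal.rpow_natCast, ← ENNReal.rpow_mul]
    norm_num
  have sqrt_sq (x : ℝ≥0∞) : (x ^ 2) ^ (1 / 2 : ℝ) = x := by
    rw [← ENNReal.rpow_natCast, ← ENNReal.rpow_mul]
    norm_num
  have factor : ∫⁻ s, k s * g s ∂μ =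
      ∫⁻ s, (k s * w s) ^ (1 / 2 : ℝ) * (k s * (w s)⁻¹ * g s ^ 2) ^ (1 / 2 : ℝ) ∂μ := by
    refine lintegral_congr_ae ?_
    filter_upwards [hw_pos] with s hs
    have cancel : k s * w s * (k s * (w s)⁻¹ * g s ^ 2) = (k s * g s) ^ 2 := by
      calc k s * w s * (k s * (w s)⁻¹ * g s ^ 2) = (w s * (w s)⁻¹) * (k s * g s) ^ 2 := by ring
        _ = (k s * g s) ^ 2 := by rw [ENNReal.mul_inv_cancel hs.1 hs.2, one_mul]
    rw [← ENNReal.mul_rpow_of_nonneg _ _ (by norm_num : (0 : ℝ) ≤ 1 / 2), cancel, sqrt_sq]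
  rw [factor]
  refine (sq_lintegral_mul_le (by fun_prop) (by fun_prop)).trans_eq ?_
  simp only [sq_sqrt]

theorem isL2Kernel_of_schur_test [SFinite μ] {K : E → E → ℝ}
    (hK : Measurable (Function.uncurry K)) {w : E → ℝ≥0∞} (hw : Measurable w)
    (hw_pos : ∀ᵐ s ∂μ, w s ≠ 0 ∧ w s ≠ ∞) (C₁ C₂ : ℝ≥0)
    (h_row : ∀ᵐ t ∂μ, ∫⁻ s, ‖K t s‖ₑ * w s ∂μ ≤ C₁ * w t)
    (h_col : ∀ᵐ s ∂μ, ∫⁻ t, ‖K t s‖ₑ * w t ∂μ ≤ C₂ * w s) : IsL2Kernel μ K := by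
  refine ⟨hK, C₁ * C₂, fun g hg => ?_⟩
  have hK_enorm : Measurable fun p : E × E => ‖K p.1 p.2‖ₑ := hK.enorm
  have hK_row (t : E) : Measurable fun s => ‖K t s‖ₑ := hK_enorm.comp measurable_prodMk_left
  have hK_col (s : E) : Measurable fun t => ‖K t s‖ₑ := hK_enorm.comp measurable_prodMk_right
  have col_bound : ∀ᵐ s ∂μ,
      ∫⁻ t, C₁ * w t * (‖K t s‖ₑ * (w s)⁻¹ * g s ^ 2) ∂μ ≤ C₁ * C₂ * g s ^ 2 := by
    filter_upwards [h_col, hw_pos] with s hs hs_pos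
    calc ∫⁻ t, C₁ * w t * (‖K t s‖ₑ * (w s)⁻¹ * g s ^ 2) ∂μ
        = ∫⁻ t, C₁ * (w s)⁻¹ * g s ^ 2 * (‖K t s‖ₑ * w t) ∂μ := lintegral_congr fun t => by ring
      _ = C₁ * (w s)⁻¹ * g s ^ 2 * ∫⁻ t, ‖K t s‖ₑ * w t ∂μ :=
          lintegral_const_mul _ ((hK_col s).mul hw)
      _ ≤ C₁ * (w s)⁻¹ * g s ^ 2 * (C₂ * w s) := by gcongr
      _ = C₁ * C₂ * g s ^ 2 * (w s * (w s)⁻¹) := by ring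
      _ = C₁ * C₂ * g s ^ 2 := by rw [ENNReal.mul_inv_cancel hs_pos.1 hs_pos.2, mul_one]
  calc ∫⁻ t, (∫⁻ s, ‖K t s‖ₑ * g s ∂μ) ^ 2 ∂μ
      ≤ ∫⁻ t, C₁ * w t * ∫⁻ s, ‖K t s‖ₑ * (w s)⁻¹ * g s ^ 2 ∂μ ∂μ := by
        refine lintegral_mono_ae ?_
        filter_upwards [h_row] with t ht
        exact (sq_lintegral_mul_le_weighted (hK_row t) hw hg hw_pos).trans (by gcongr)
    _ = ∫⁻ t, ∫⁻ s, C₁ * w t * (‖K t s‖ₑ * (w s)⁻¹ * g s ^ 2) ∂μ ∂μ :=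
        lintegral_congr fun t =>
          (lintegral_const_mul _ (((hK_row t).mul hw.inv).mul (hg.pow_const 2))).symm
    _ = ∫⁻ s, ∫⁻ t, C₁ * w t * (‖K t s‖ₑ * (w s)⁻¹ * g s ^ 2) ∂μ ∂μ := by
        refine lintegral_lintegral_swap (Measurable.aemeasurable ?_)
        change Measurable fun p : E × E => C₁ * w p.1 * (‖K p.1 p.2‖ₑ * (w p.2)⁻¹ * g p.2 ^ 2)
        fun_prop
    _ ≤ ∫⁻ s, C₁ * C₂ * g s ^ 2 ∂μ := lintegral_mono_ae col_bound
    _ = ((C₁ * C₂ : ℝ≥0) : ℝ≥0∞) * ∫⁻ s, g s ^ 2 ∂μ := by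
        rw [lintegral_const_mul _ (by fun_prop), ENNReal.coe_mul]

namespace IsL2Kernel

variable {K K' : E → E → ℝ} {f : E → ℝ}

theorem const_mul (hK : IsL2Kernel μ K) (c : ℝ) : IsL2Kernel μ fun t s => c * K t s := by
  obtain ⟨hK_meas, C, hC⟩ := hK
  refine ⟨hK_meas.const_mul c, ‖c‖₊ ^ 2 * C, fun g hg => ?_⟩
  have pull_out (t : E) :
      (∫⁻ s, ‖c * K t s‖ₑ * g s ∂μ) ^ 2 = ‖c‖ₑ ^ 2 * (∫⁻ s, ‖K t s‖ₑ * g s ∂μ) ^ 2 := by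
    simp only [enorm_mul, mul_assoc]
    rw [lintegral_const_mul' _ _ enorm_ne_top, mul_pow]
  calc ∫⁻ t, (∫⁻ s, ‖c * K t s‖ₑ * g s ∂μ) ^ 2 ∂μ
      = ‖c‖ₑ ^ 2 * ∫⁻ t, (∫⁻ s, ‖K t s‖ₑ * g s ∂μ) ^ 2 ∂μ := by
        simp only [pull_out]
        exact lintegral_const_mul' _ _ (by finiteness)
    _ ≤ ‖c‖ₑ ^ 2 * (C * ∫⁻ s, g s ^ 2 ∂μ) := by gcongr; exact hC g hg
    _ = ((‖c‖₊ ^ 2 * C : ℝ≥0) : ℝ≥0∞) * ∫⁻ s, g s ^ 2 ∂μ := by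
        simp [mul_assoc, enorm_eq_nnnorm]

theorem of_abs_le (hK : IsL2Kernel μ K) (hK' : Measurable (Function.uncurry K'))
    (h_le : ∀ t s, |K' t s| ≤ K t s) : IsL2Kernel μ K' := by
  obtain ⟨_, C, hC⟩ := hK
  refine ⟨hK', C, fun g hg => le_trans ?_ (hC g hg)⟩
  gcongr with t s
  rw [← ofReal_norm, ← ofReal_norm]
  exact ENNReal.ofReal_le_ofReal ((h_le t s).trans (le_abs_self _))

theorem abs (hK : IsL2Kernel μ K) : IsL2Kernel μ fun t s => |K t s| := by
  obtain ⟨C, hC⟩ := hK.bound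
  refine ⟨hK.measurable.norm, C, fun g hg => ?_⟩
  simpa [Real.enorm_abs] using hC g hg

theorem measurable_left (hK : IsL2Kernel μ K) (t : E) : Measurable (K t) :=
  hK.measurable.comp measurable_prodMk_left

theorem exists_lintegral_le (hK : IsL2Kernel μ K) : ∃ C : ℝ≥0, ∀ f : E → ℝ,
    AEStronglyMeasurable f μ →
    ∫⁻ t, (∫⁻ s, ‖K t s * f s‖ₑ ∂μ) ^ 2 ∂μ ≤ C * ∫⁻ s, ‖f s‖ₑ ^ 2 ∂μ := by
  obtain ⟨C, hC⟩ := hK.bound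
  refine ⟨C, fun f hf => ?_⟩
  have inner_eq (t : E) : ∫⁻ s, ‖K t s * f s‖ₑ ∂μ = ∫⁻ s, ‖K t s‖ₑ * ‖hf.mk f s‖ₑ ∂μ := by
    refine lintegral_congr_ae ?_
    filter_upwards [hf.ae_eq_mk] with s hs
    rw [enorm_mul, hs]
  have norm_eq : ∫⁻ s, ‖f s‖ₑ ^ 2 ∂μ = ∫⁻ s, ‖hf.mk f s‖ₑ ^ 2 ∂μ := by
    refine lintegral_congr_ae ?_
    filter_upwards [hf.ae_eq_mk] with s hs
    rw [hs]
  simp only [inner_eq]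
  rw [norm_eq]
  exact hC _ hf.stronglyMeasurable_mk.measurable.enorm

theorem exists_eLpNorm_le (hK : IsL2Kernel μ K) : ∃ C : ℝ≥0, ∀ f : E → ℝ,
    AEStronglyMeasurable f μ →
      eLpNorm (fun t => ∫ s, K t s * f s ∂μ) 2 μ ≤ C * eLpNorm f 2 μ := by
  obtain ⟨C, hC⟩ := hK.exists_lintegral_le
  refine ⟨NNReal.sqrt C, fun f hf => ?_⟩
  have sqrt_coe : ((NNReal.sqrt C : ℝ≥0) : ℝ≥0∞) = (C : ℝ≥0∞) ^ (1 / 2 : ℝ) := by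
    rw [NNReal.sqrt_eq_rpow, ENNReal.coe_rpow_of_nonneg _ (by norm_num)]
  rw [eLpNorm_eq_lintegral_rpow_enorm_toReal two_ne_zero ENNReal.ofNat_ne_top,
    eLpNorm_eq_lintegral_rpow_enorm_toReal two_ne_zero ENNReal.ofNat_ne_top, sqrt_coe]
  simp only [ENNReal.toReal_ofNat, ENNReal.rpow_ofNat]
  rw [← ENNReal.mul_rpow_of_nonneg _ _ (by norm_num : (0 : ℝ) ≤ 1 / 2)]
  refine ENNReal.rpow_le_rpow (le_trans ?_ (hC f hf)) (by norm_num)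
  gcongr
  exact enorm_integral_le_lintegral_enorm _

theorem aestronglyMeasurable_mul (hK : IsL2Kernel μ K) (hf : AEStronglyMeasurable f μ) :
    AEStronglyMeasurable (fun p : E × E => K p.1 p.2 * f p.2) (μ.prod μ) :=
  hK.measurable.aestronglyMeasurable.mul hf.comp_snd

variable [SFinite μ]

theorem ae_integrable (hK : IsL2Kernel μ K) (hf : MemLp f 2 μ) :
    ∀ᵐ t ∂μ, Integrable (fun s => K t s * f s) μ := by
  obtain ⟨C, hC⟩ := hK.exists_lintegral_le
  have hf_sq : ∫⁻ s, ‖f s‖ₑ ^ 2 ∂μ < ∞ := by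
    simpa using lintegral_rpow_enorm_lt_top_of_eLpNorm_lt_top two_ne_zero ENNReal.ofNat_ne_top hf.2
  have h_sq : ∫⁻ t, (∫⁻ s, ‖K t s * f s‖ₑ ∂μ) ^ 2 ∂μ < ∞ :=
    (hC f hf.1).trans_lt (ENNReal.mul_lt_top ENNReal.coe_lt_top hf_sq)
  have h_meas : AEMeasurable (fun t => ∫⁻ s, ‖K t s * f s‖ₑ ∂μ) μ :=
    (hK.aestronglyMeasurable_mul hf.1).enorm.lintegral_prod_right'
  filter_upwards [ae_lt_top' (h_meas.pow_const 2) h_sq.ne] with t ht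
  exact ⟨(hK.measurable_left t).aestronglyMeasurable.mul hf.1,
    (ENNReal.pow_lt_top_iff.1 ht).resolve_right two_ne_zero⟩

theorem memLp_integral (hK : IsL2Kernel μ K) (hf : MemLp f 2 μ) :
    MemLp (fun t => ∫ s, K t s * f s ∂μ) 2 μ := by
  obtain ⟨C, hC⟩ := hK.exists_eLpNorm_le
  exact ⟨(hK.aestronglyMeasurable_mul hf.1).integral_prod_right',
    (hC f hf.1).trans_lt (ENNReal.mul_lt_top ENNReal.coe_lt_top hf.2)⟩

/-- The integral operator `f ↦ ∫ K(·, s) f(s) dμ(s)` on `L²(μ)`, as a linear map. -/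
def opₗ (hK : IsL2Kernel μ K) : Lp ℝ 2 μ →ₗ[ℝ] Lp ℝ 2 μ where
  toFun f := (hK.memLp_integral (Lp.memLp f)).toLp _
  map_add' f g := by
    rw [← MemLp.toLp_add]
    refine (MemLp.toLp_eq_toLp_iff _ _).2 ?_
    filter_upwards [hK.ae_integrable (Lp.memLp f), hK.ae_integrable (Lp.memLp g)] with t hf hg
    rw [Pi.add_apply, ← integral_add hf hg]
    refine integral_congr_ae ?_
    filter_upwards [Lp.coeFn_add f g] with s hs
    rw [hs, Pi.add_apply, mul_add]
  map_smul' c f := by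
    rw [RingHom.id_apply, ← MemLp.toLp_const_smul]
    refine (MemLp.toLp_eq_toLp_iff _ _).2 (Filter.Eventually.of_forall fun t => ?_)
    rw [Pi.smul_apply, smul_eq_mul, ← integral_const_mul]
    refine integral_congr_ae ?_
    filter_upwards [Lp.coeFn_smul c f] with s hs
    rw [hs, Pi.smul_apply, smul_eq_mul, mul_left_comm]

theorem exists_norm_opₗ_le (hK : IsL2Kernel μ K) : ∃ C : ℝ, ∀ f, ‖hK.opₗ f‖ ≤ C * ‖f‖ := by
  obtain ⟨C, hC⟩ := hK.exists_eLpNorm_le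
  refine ⟨C, fun f => ?_⟩
  simp only [opₗ, LinearMap.coe_mk, AddHom.coe_mk, Lp.norm_toLp]
  rw [Lp.norm_def, ← ENNReal.coe_toReal, ← ENNReal.toReal_mul]
  exact ENNReal.toReal_mono (ENNReal.mul_ne_top ENNReal.coe_ne_top (Lp.eLpNorm_ne_top f))
    (hC f (Lp.aestronglyMeasurable f))

/-- The integral operator `f ↦ ∫ K(·, s) f(s) dμ(s)` on `L²(μ)`, as a continuous linear map. -/
def op (hK : IsL2Kernel μ K) : Lp ℝ 2 μ →L[ℝ] Lp ℝ 2 μ :=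
  hK.opₗ.mkContinuousOfExistsBound hK.exists_norm_opₗ_le

theorem op_ae_eq (hK : IsL2Kernel μ K) (f : Lp ℝ 2 μ) :
    hK.op f =ᵐ[μ] fun t => ∫ s, K t s * f s ∂μ :=
  (hK.memLp_integral (Lp.memLp f)).coeFn_toLp

theorem op_toLp_ae_eq (hK : IsL2Kernel μ K) (hf : MemLp f 2 μ) :
    hK.op (hf.toLp f) =ᵐ[μ] fun t => ∫ s, K t s * f s ∂μ := by
  refine (hK.op_ae_eq _).trans (Filter.Eventually.of_forall fun t => integral_congr_ae ?_)
  filter_upwards [hf.coeFn_toLp] with s hs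
  rw [hs]

theorem ae_integrable_mul_mul (hK : IsL2Kernel μ K) (hK' : IsL2Kernel μ K')
    (hf : MemLp f 2 μ) :
    ∀ᵐ t ∂μ, Integrable (fun p : E × E => K t p.1 * (K' p.1 p.2 * f p.2)) (μ.prod μ) := by
  filter_upwards [hK.ae_integrable (hK'.abs.memLp_integral hf.norm)] with t h_abs
  have h_meas : AEStronglyMeasurable (fun p : E × E => K t p.1 * (K' p.1 p.2 * f p.2))
      (μ.prod μ) :=
    ((hK.measurable_left t).comp measurable_fst).aestronglyMeasurable.mul
      (hK'.aestronglyMeasurable_mul hf.1)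
  refine (integrable_prod_iff h_meas).2 ⟨?_, ?_⟩
  · filter_upwards [hK'.ae_integrable hf] with u hu using hu.const_mul (K t u)
  · refine h_abs.norm.congr (Filter.Eventually.of_forall fun u => ?_)
    have h_nonneg : 0 ≤ ∫ s, ‖K' u s‖ * ‖f s‖ ∂μ := integral_nonneg fun s => by positivity
    simp only [← Real.norm_eq_abs, norm_mul, integral_const_mul,
      Real.norm_of_nonneg h_nonneg]

theorem op_comp_ae_eq (hK : IsL2Kernel μ K) (hK' : IsL2Kernel μ K') (f : Lp ℝ 2 μ) :
    hK.op (hK'.op f) =ᵐ[μ] fun t => ∫ s, (∫ u, K t u * K' u s ∂μ) * f s ∂μ := by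
  filter_upwards [hK.op_ae_eq (hK'.op f), hK.ae_integrable_mul_mul hK' (Lp.memLp f)]
    with t ht h_int
  have inner_eq : ∀ᵐ u ∂μ, K t u * hK'.op f u = ∫ s, K t u * (K' u s * f s) ∂μ := by
    filter_upwards [hK'.op_ae_eq f] with u hu
    rw [hu, ← integral_const_mul]
  rw [ht, integral_congr_ae inner_eq, integral_integral_swap h_int]
  simp only [← mul_assoc, integral_mul_const]

end IsL2Kernel

end L2Kernel

/-! ### Abel kernels and their resolvent -/

section Gamma

variable {u v x α : ℝ}

theorem integral_rpow_mul_sub_rpow (hu : 0 < u) (hv : 0 < v) (hx : 0 < x) :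
    ∫ t in (0 : ℝ)..x, t ^ (u - 1) * (x - t) ^ (v - 1) =
      x ^ (u + v - 1) * (Real.Gamma u * Real.Gamma v / Real.Gamma (u + v)) := by
  have scaled := Complex.betaIntegral_scaled (u : ℂ) (v : ℂ) hx
  have real_integrand : ∫ t in (0 : ℝ)..x, (t : ℂ) ^ ((u : ℂ) - 1) * ((x : ℂ) - t) ^ ((v : ℂ) - 1) =
      ∫ t in (0 : ℝ)..x, ((t ^ (u - 1) * (x - t) ^ (v - 1) : ℝ) : ℂ) := by
    refine intervalIntegral.integral_congr fun t ht => ?_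
    rw [uIcc_of_le hx.le] at ht
    rw [Complex.ofReal_mul, Complex.ofReal_cpow ht.1, Complex.ofReal_cpow (by linarith [ht.2])]
    push_cast
    rfl
  rw [Complex.betaIntegral_eq_Gamma_mul_div _ _ (by simpa) (by simpa), real_integrand,
    intervalIntegral.integral_ofReal] at scaled
  apply Complex.ofReal_injective
  rw [scaled, Complex.ofReal_mul, Complex.ofReal_cpow hx.le]
  push_cast
  rw [← Complex.Gamma_ofReal, ← Complex.Gamma_ofReal, ← Complex.Gamma_ofReal]
  push_cast
  rfl

theorem intervalIntegrable_rpow_mul_sub_rpow (hu : 0 < u) (hv : 0 < v) (hx : 0 < x) :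
    IntervalIntegrable (fun t => t ^ (u - 1) * (x - t) ^ (v - 1)) volume 0 x := by
  refine intervalIntegral.intervalIntegrable_of_integral_ne_zero ?_
  have := Real.Gamma_pos_of_pos hu
  have := Real.Gamma_pos_of_pos hv
  have := Real.Gamma_pos_of_pos (add_pos hu hv)
  rw [integral_rpow_mul_sub_rpow hu hv hx]
  positivity

-- Only the part of the Gamma integral over `(A, A + 1]` is kept.
theorem rpow_mul_exp_le_Gamma {A y : ℝ} (hA : 0 < A) (hy : 1 ≤ y) :
    A ^ (y - 1) * Real.exp (-(A + 1)) ≤ Real.Gamma y := by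
  have h_int := Real.GammaIntegral_convergent (s := y) (by linarith)
  have h_subset : Ioc A (A + 1) ⊆ Ioi 0 := fun x hx => hA.trans hx.1
  calc A ^ (y - 1) * Real.exp (-(A + 1))
      = ∫ _ in Ioc A (A + 1), A ^ (y - 1) * Real.exp (-(A + 1)) := by simp
    _ ≤ ∫ x in Ioc A (A + 1), Real.exp (-x) * x ^ (y - 1) := by
        refine setIntegral_mono_on (integrableOn_const (by simp)) (h_int.mono_set h_subset)
          measurableSet_Ioc fun x hx => ?_
        have h_rpow : A ^ (y - 1) ≤ x ^ (y - 1) := Real.rpow_le_rpow hA.le hx.1.le (by linarith)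
        have h_exp : Real.exp (-(A + 1)) ≤ Real.exp (-x) := Real.exp_le_exp.2 (by linarith [hx.2])
        rw [mul_comm]
        gcongr
    _ ≤ ∫ x in Ioi 0, Real.exp (-x) * x ^ (y - 1) := by
        refine setIntegral_mono_set h_int ?_ h_subset.eventuallyLE
        filter_upwards [ae_restrict_mem measurableSet_Ioi] with x hx
        exact mul_nonneg (Real.exp_pos _).le (Real.rpow_nonneg (le_of_lt hx) _)
    _ = Real.Gamma y := (Real.Gamma_eq_integral (by linarith)).symm

theorem summable_pow_div_Gamma (hα : 0 < α) {y : ℝ} (hy : 0 ≤ y) :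
    Summable fun k : ℕ => y ^ k / Real.Gamma (k * α) := by
  -- `A` is chosen so that the lower bound on `Γ(kα)` grows like `(2 y + 1) ^ k`.
  set A : ℝ := (2 * y + 1) ^ (1 / α) with hA_def
  have hA : 0 < A := by positivity
  have hA_rpow : A ^ α = 2 * y + 1 := by
    rw [hA_def, ← Real.rpow_mul (by positivity), one_div_mul_cancel hα.ne', Real.rpow_one]
  have h_ratio : y / (2 * y + 1) < 1 := by rw [div_lt_one (by positivity)]; linarith
  have h_geometric : Summable fun k : ℕ => A * Real.exp (A + 1) * (y / (2 * y + 1)) ^ k :=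
    (summable_geometric_of_lt_one (by positivity) h_ratio).mul_left _
  refine Summable.of_norm_bounded_eventually_nat h_geometric ?_
  obtain ⟨N, hN⟩ := exists_nat_gt (1 / α)
  filter_upwards [Filter.eventually_ge_atTop N] with k hk
  have h_one_le : 1 ≤ k * α := by
    have : (N : ℝ) ≤ k := by exact_mod_cast hk
    rw [div_lt_iff₀ hα] at hN
    nlinarith
  have h_Gamma := rpow_mul_exp_le_Gamma hA h_one_le
  have h_pos : 0 < A ^ (k * α - 1) * Real.exp (-(A + 1)) := by positivity
  rw [Real.norm_of_nonneg (div_nonneg (by positivity) (h_pos.le.trans h_Gamma))]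
  calc y ^ k / Real.Gamma (k * α) ≤ y ^ k / (A ^ (k * α - 1) * Real.exp (-(A + 1))) := by gcongr
    _ = A * Real.exp (A + 1) * (y / (2 * y + 1)) ^ k := by
        rw [Real.rpow_sub hA, mul_comm (k : ℝ) α, Real.rpow_mul hA.le, hA_rpow,
          Real.rpow_natCast, Real.rpow_one, Real.exp_neg, div_pow]
        field_simp

end Gamma

section Abel

/-- The convolution `∫_0^x θ₁(v) θ₂(x - v) dv` of functions on the half-line. -/
def volterraConv (θ₁ θ₂ : ℝ → ℝ) (x : ℝ) : ℝ := ∫ v in (0 : ℝ)..x, θ₁ v * θ₂ (x - v)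

/-- The `k`-th convolution power of the Abel kernel `z x ^ (α - 1) / Γ(α)`. It vanishes for `k = 0`
by the convention `Γ(0) = 0`. -/
def abelPow (α z : ℝ) (k : ℕ) (x : ℝ) : ℝ := z ^ k / Real.Gamma (k * α) * x ^ (k * α - 1)

/-- The resolvent of the Abel kernel: the sum of its convolution powers of positive exponent. -/
def abelResolvent (α z x : ℝ) : ℝ := ∑' k : ℕ, abelPow α z (k + 1) x

theorem volterraConv_comm (θ₁ θ₂ : ℝ → ℝ) (x : ℝ) :
    volterraConv θ₁ θ₂ x = volterraConv θ₂ θ₁ x := by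
  have reflect := intervalIntegral.integral_comp_sub_left (a := 0) (b := x)
    (fun v => θ₁ v * θ₂ (x - v)) x
  simp only [sub_sub_cancel, sub_self, sub_zero] at reflect
  rw [volterraConv, volterraConv, ← reflect]
  exact intervalIntegral.integral_congr fun v _ => mul_comm _ _

@[fun_prop]
theorem measurable_abelPow (α z : ℝ) (k : ℕ) : Measurable (abelPow α z k) := by
  unfold abelPow
  fun_prop

@[fun_prop]
theorem measurable_abelResolvent (α z : ℝ) : Measurable (abelResolvent α z) :=
  Measurable.tsum fun k => measurable_abelPow α z (k + 1)

theorem abelPow_mul_left (α c z : ℝ) (k : ℕ) (x : ℝ) :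
    abelPow α (c * z) k x = c ^ k * abelPow α z k x := by
  rw [abelPow, abelPow, mul_pow]
  ring

variable {α : ℝ}

theorem abs_abelPow (hα : 0 < α) (z : ℝ) (k : ℕ) {x : ℝ} (hx : 0 ≤ x) :
    |abelPow α z k x| = abelPow α |z| k x := by
  have : 0 ≤ Real.Gamma (k * α) := Real.Gamma_nonneg_of_nonneg (by positivity)
  rw [abelPow, abelPow, abs_mul, abs_div, abs_pow, abs_of_nonneg this,
    abs_of_nonneg (Real.rpow_nonneg hx _)]

theorem summable_abelPow (hα : 0 < α) (z : ℝ) {x : ℝ} (hx : 0 < x) :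
    Summable fun k : ℕ => abelPow α z k x := by
  have series := (summable_pow_div_Gamma hα (y := |z| * x ^ α) (by positivity)).mul_right x⁻¹
  refine Summable.of_norm (series.congr fun k => ?_)
  rw [Real.norm_eq_abs, abs_abelPow hα z k hx.le, abelPow, mul_pow, ← Real.rpow_natCast (x ^ α),
    ← Real.rpow_mul hx.le, mul_comm α, Real.rpow_sub hx, Real.rpow_one]
  ring

theorem abs_abelPow_succ_le (hα : 0 < α) (z : ℝ) {x T : ℝ} (hx : x ∈ Ioc 0 T) (k : ℕ) :
    |abelPow α z (k + 1) x| ≤ abelPow α |z| (k + 1) T * T ^ (1 - α) * x ^ (α - 1) := by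
  have hT : 0 < T := hx.1.trans_le hx.2
  have : 0 < Real.Gamma ((k + 1 : ℕ) * α) := Real.Gamma_pos_of_pos (by positivity)
  have split {y : ℝ} (hy : 0 < y) : y ^ ((k + 1 : ℕ) * α - 1) = y ^ (k * α) * y ^ (α - 1) := by
    rw [← Real.rpow_add hy]
    congr 1
    push_cast
    ring
  have cancel : T ^ (α - 1) * T ^ (1 - α) = 1 := by
    rw [← Real.rpow_add hT]
    simp
  calc |abelPow α z (k + 1) x|
      = |z| ^ (k + 1) / Real.Gamma ((k + 1 : ℕ) * α) * (x ^ (k * α) * x ^ (α - 1)) := by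
        rw [abs_abelPow hα z _ hx.1.le, abelPow, split hx.1]
    _ ≤ |z| ^ (k + 1) / Real.Gamma ((k + 1 : ℕ) * α) * (T ^ (k * α) * x ^ (α - 1)) := by
        have := hx.1
        gcongr
        exact hx.2
    _ = |z| ^ (k + 1) / Real.Gamma ((k + 1 : ℕ) * α) *
          (T ^ (k * α) * (T ^ (α - 1) * T ^ (1 - α)) * x ^ (α - 1)) := by rw [cancel, mul_one]
    _ = abelPow α |z| (k + 1) T * T ^ (1 - α) * x ^ (α - 1) := by
        rw [abelPow, split hT]
        ring

theorem abs_abelResolvent_le (hα : 0 < α) (z : ℝ) {x T : ℝ} (hx : x ∈ Ioc 0 T) :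
    |abelResolvent α z x| ≤ abelResolvent α |z| T * T ^ (1 - α) * x ^ (α - 1) := by
  have h_sum := (summable_nat_add_iff 1).2 (summable_abelPow hα |z| (hx.1.trans_le hx.2))
  exact tsum_of_norm_bounded (f := fun k => abelPow α z (k + 1) x)
    ((h_sum.hasSum.mul_right _).mul_right _) fun k => abs_abelPow_succ_le hα z hx k

variable {j k : ℕ} {x : ℝ}

theorem volterraConv_abelPow (hα : 0 < α) (z : ℝ) (hj : j ≠ 0) (hk : k ≠ 0) (hx : 0 < x) :
    volterraConv (abelPow α z j) (abelPow α z k) x = abelPow α z (j + k) x := by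
  have hjα : 0 < j * α := by positivity
  have hkα : 0 < k * α := by positivity
  have := Real.Gamma_pos_of_pos hjα
  have := Real.Gamma_pos_of_pos hkα
  have beta := integral_rpow_mul_sub_rpow hjα hkα hx
  rw [← add_mul, ← Nat.cast_add] at beta
  have integrand (v : ℝ) : abelPow α z j v * abelPow α z k (x - v) =
      z ^ j / Real.Gamma (j * α) * (z ^ k / Real.Gamma (k * α)) *
        (v ^ (j * α - 1) * (x - v) ^ (k * α - 1)) := by
    simp only [abelPow]
    ring
  simp only [volterraConv, integrand]
  rw [intervalIntegral.integral_const_mul, beta, abelPow]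
  field_simp
  ring

theorem intervalIntegrable_abelPow_mul (hα : 0 < α) (z : ℝ) (hj : j ≠ 0) (hk : k ≠ 0) (hx : 0 < x) :
    IntervalIntegrable (fun v => abelPow α z j v * abelPow α z k (x - v)) volume 0 x := by
  have hjα : 0 < j * α := by positivity
  have hkα : 0 < k * α := by positivity
  refine ((intervalIntegrable_rpow_mul_sub_rpow hjα hkα hx).const_mul
    (z ^ j / Real.Gamma (j * α) * (z ^ k / Real.Gamma (k * α)))).congr fun v _ => ?_
  simp only [abelPow]
  ring

theorem volterraConv_abelPow_one_abelResolvent (hα : 0 < α) (z : ℝ) (hx : 0 < x) :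
    volterraConv (abelPow α z 1) (abelResolvent α z) x =
      abelResolvent α z x - abelPow α z 1 x := by
  have h_int (k : ℕ) : IntegrableOn (fun v => abelPow α z 1 v * abelPow α z (k + 1) (x - v))
      (Ioc 0 x) :=
    (intervalIntegrable_iff_integrableOn_Ioc_of_le hx.le).1
      (intervalIntegrable_abelPow_mul hα z one_ne_zero k.succ_ne_zero hx)
  have h_conv (z : ℝ) (k : ℕ) : ∫ v in Ioc 0 x, abelPow α z 1 v * abelPow α z (k + 1) (x - v) =
      abelPow α z (k + 2) x := by
    rw [← intervalIntegral.integral_of_le hx.le]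
    exact (volterraConv_abelPow hα z one_ne_zero k.succ_ne_zero hx).trans (by rw [add_comm]; rfl)
  have h_norm (k : ℕ) : ∫ v in Ioc 0 x, ‖abelPow α z 1 v * abelPow α z (k + 1) (x - v)‖ =
      abelPow α |z| (k + 2) x := by
    rw [← h_conv]
    refine setIntegral_congr_fun measurableSet_Ioc fun v hv => ?_
    simp only [norm_mul, Real.norm_eq_abs]
    rw [abs_abelPow hα z 1 hv.1.le, abs_abelPow hα z (k + 1) (sub_nonneg.2 hv.2)]
  have h_summable (z : ℝ) (n : ℕ) : Summable fun k : ℕ => abelPow α z (k + n) x :=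
    (summable_nat_add_iff n).2 (summable_abelPow hα z hx)
  calc volterraConv (abelPow α z 1) (abelResolvent α z) x
      = ∫ v in Ioc 0 x, ∑' k : ℕ, abelPow α z 1 v * abelPow α z (k + 1) (x - v) := by
        rw [volterraConv, intervalIntegral.integral_of_le hx.le]
        simp only [abelResolvent, tsum_mul_left]
    _ = ∑' k : ℕ, abelPow α z (k + 2) x := by
        rw [← integral_tsum_of_summable_integral_norm h_int
          (by simpa only [h_norm] using h_summable |z| 2)]
        simp only [h_conv]
    _ = abelResolvent α z x - abelPow α z 1 x := by
        rw [abelResolvent, (h_summable z 1).tsum_eq_zero_add]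
        simp

end Abel

/-! ### Weighted Volterra convolution kernels -/

/-- The class of convolution profiles at most as singular at the origin as `x ^ (α - 1)`; these are
the profiles for which `volterraKer α T θ` defines a bounded operator on `L²[0, T]`. -/
structure IsWeaklySingular (α T : ℝ) (θ : ℝ → ℝ) : Prop where
  measurable : Measurable θ
  bound : ∃ M, ∀ x ∈ Ioc 0 T, |θ x| ≤ M * x ^ (α - 1)

/-- The Volterra kernel `t ^ (-α) s ^ α θ (s - t)`, `0 < t < s ≤ T`: convolution with the profile
`θ`, conjugated by multiplication with `s ^ α`. -/
def volterraKer (α T : ℝ) (θ : ℝ → ℝ) (t s : ℝ) : ℝ :=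
  if 0 < t ∧ t < s ∧ s ≤ T then t ^ (-α) * s ^ α * θ (s - t) else 0

theorem isWeaklySingular_abelPow_succ {α : ℝ} (hα : 0 < α) (T z : ℝ) (k : ℕ) :
    IsWeaklySingular α T (abelPow α z (k + 1)) where
  measurable := measurable_abelPow α z (k + 1)
  bound := ⟨_, fun _ hx => abs_abelPow_succ_le hα z hx k⟩

theorem isWeaklySingular_abelPow_one {α : ℝ} (hα : 0 < α) (T z : ℝ) :
    IsWeaklySingular α T (abelPow α z 1) :=
  isWeaklySingular_abelPow_succ hα T z 0

theorem isWeaklySingular_abelResolvent {α : ℝ} (hα : 0 < α) (T z : ℝ) :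
    IsWeaklySingular α T (abelResolvent α z) where
  measurable := measurable_abelResolvent α z
  bound := ⟨_, fun _ hx => abs_abelResolvent_le hα z hx⟩

theorem ae_leb_mem_Ioo (T : ℝ) : ∀ᵐ t ∂leb T, t ∈ Ioo 0 T := by
  rw [leb, ← restrict_Ioo_eq_restrict_Icc]
  exact ae_restrict_mem measurableSet_Ioo

theorem leb_restrict_Ioc {t : ℝ} (ht : 0 ≤ t) (T : ℝ) :
    (leb T).restrict (Ioc t T) = volume.restrict (Ioc t T) := by
  have h_sub : Ioc t T ⊆ Icc 0 T := fun _ hx => ⟨ht.trans hx.1.le, hx.2⟩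
  rw [Measure.restrict_restrict measurableSet_Ioc, inter_eq_left.2 h_sub]

theorem lintegral_indicator_Ioc_leb_le {a b : ℝ} (hab : a ≤ b) {f : ℝ → ℝ}
    (hf : IntervalIntegrable f volume a b) (h_nonneg : ∀ x ∈ Ioc a b, 0 ≤ f x) (T : ℝ) :
    ∫⁻ x, (Ioc a b).indicator (fun x => ENNReal.ofReal (f x)) x ∂leb T ≤
      ENNReal.ofReal (∫ x in a..b, f x) := by
  rw [intervalIntegral.integral_of_le hab, ofReal_integral_eq_lintegral_ofReal
    ((intervalIntegrable_iff_integrableOn_Ioc_of_le hab).1 hf)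
    ((ae_restrict_iff' measurableSet_Ioc).2 (Filter.Eventually.of_forall h_nonneg)),
    ← lintegral_indicator measurableSet_Ioc]
  exact lintegral_mono' Measure.restrict_le_self le_rfl

theorem intervalIntegrable_sub_rpow {α : ℝ} (hα : 0 < α) (t b : ℝ) :
    IntervalIntegrable (fun s => (s - t) ^ (α - 1)) volume t b := by
  simpa using (intervalIntegral.intervalIntegrable_rpow' (a := 0) (b := b - t) (r := α - 1)
    (by linarith)).comp_sub_right t

theorem measurable_volterraKer (α T : ℝ) {θ : ℝ → ℝ} (hθ : Measurable θ) :
    Measurable (Function.uncurry (volterraKer α T θ)) := by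
  refine Measurable.ite ?_ (by fun_prop) measurable_const
  exact (measurableSet_lt measurable_const measurable_fst).inter
    ((measurableSet_lt measurable_fst measurable_snd).inter
      (measurableSet_le measurable_snd measurable_const))

section Basic

variable {α T t s : ℝ} {θ : ℝ → ℝ}

theorem volterraKer_of_nonpos (ht : t ≤ 0) (s : ℝ) : volterraKer α T θ t s = 0 :=
  if_neg fun h => h.1.not_ge ht

theorem volterraKer_of_notMem_Ioc (hs : s ∉ Ioc t T) : volterraKer α T θ t s = 0 :=
  if_neg fun h => hs h.2

theorem volterraKer_of_mem_Ioc (ht : 0 < t) (hs : s ∈ Ioc t T) :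
    volterraKer α T θ t s = t ^ (-α) * s ^ α * θ (s - t) :=
  if_pos ⟨ht, hs⟩

theorem volterraKer_mul_eq_indicator (ht : 0 < t) (f : ℝ → ℝ) (s : ℝ) :
    volterraKer α T θ t s * f s =
      (Ioc t T).indicator (fun s => t ^ (-α) * s ^ α * θ (s - t) * f s) s := by
  by_cases hs : s ∈ Ioc t T
  · rw [indicator_of_mem hs, volterraKer_of_mem_Ioc ht hs]
  · rw [indicator_of_notMem hs, volterraKer_of_notMem_Ioc hs, zero_mul]

theorem volterraKer_eq_indicator (ht : 0 < t) (s : ℝ) :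
    volterraKer α T θ t s = (Ioc t T).indicator (fun s => t ^ (-α) * s ^ α * θ (s - t)) s := by
  simpa using volterraKer_mul_eq_indicator ht (fun _ => 1) s

theorem volterraKer_congr {θ' : ℝ → ℝ} (h : ∀ x, 0 < x → θ x = θ' x) (t s : ℝ) :
    volterraKer α T θ t s = volterraKer α T θ' t s := by
  unfold volterraKer
  split_ifs with hc
  · rw [h _ (sub_pos.2 hc.2.1)]
  · rfl

theorem volterraKer_sub (θ₁ θ₂ : ℝ → ℝ) (t s : ℝ) :
    volterraKer α T (fun x => θ₁ x - θ₂ x) t s =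
      volterraKer α T θ₁ t s - volterraKer α T θ₂ t s := by
  unfold volterraKer
  split_ifs <;> ring

theorem volterraKer_abelPow_mul (c z : ℝ) (k : ℕ) (t s : ℝ) :
    volterraKer α T (abelPow α (c * z) k) t s = c ^ k * volterraKer α T (abelPow α z k) t s := by
  simp only [volterraKer, abelPow_mul_left, mul_ite, mul_zero]
  congr 1
  ring

theorem abs_volterraKer_le {M : ℝ} (hM : ∀ x ∈ Ioc 0 T, |θ x| ≤ M * x ^ (α - 1)) (t s : ℝ) :
    |volterraKer α T θ t s| ≤ M * volterraKer α T (fun x => x ^ (α - 1)) t s := by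
  unfold volterraKer
  split_ifs with h
  · obtain ⟨ht, hts, hsT⟩ := h
    have hs : 0 < s := ht.trans hts
    have hθ := hM (s - t) ⟨sub_pos.2 hts, by linarith⟩
    rw [abs_mul, abs_of_nonneg (by positivity)]
    calc t ^ (-α) * s ^ α * |θ (s - t)| ≤ t ^ (-α) * s ^ α * (M * (s - t) ^ (α - 1)) := by gcongr
      _ = _ := by ring
  · simp

end Basic

section SchurTest

variable {α T t s : ℝ}

theorem lintegral_volterraKer_rpow_row_le (hα : 0 < α) (ht : t ∈ Ioo 0 T) :
    ∫⁻ s, ‖volterraKer α T (fun x => x ^ (α - 1)) t s‖ₑ * ENNReal.ofReal (s ^ (-α)) ∂leb T ≤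
      (T ^ α / α).toNNReal * ENNReal.ofReal (t ^ (-α)) := by
  have ht_pos := ht.1
  have h_eq : ∀ s, ‖volterraKer α T (fun x => x ^ (α - 1)) t s‖ₑ * ENNReal.ofReal (s ^ (-α)) =
      (Ioc t T).indicator (fun s => ENNReal.ofReal (t ^ (-α) * (s - t) ^ (α - 1))) s := by
    intro s
    by_cases hs : s ∈ Ioc t T
    · have hs_pos : 0 < s := ht_pos.trans hs.1
      have hst : 0 < s - t := sub_pos.2 hs.1
      rw [indicator_of_mem hs, volterraKer_of_mem_Ioc ht_pos hs,
        Real.enorm_of_nonneg (by positivity), ← ENNReal.ofReal_mul (by positivity)]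
      congr 1
      rw [Real.rpow_neg hs_pos.le]
      field_simp
    · rw [indicator_of_notMem hs, volterraKer_of_notMem_Ioc hs, enorm_zero, zero_mul]
  simp only [h_eq]
  refine (lintegral_indicator_Ioc_leb_le ht.2.le ((intervalIntegrable_sub_rpow hα t T).const_mul _)
    (fun s hs => mul_nonneg (by positivity) (Real.rpow_nonneg (sub_nonneg.2 hs.1.le) _)) T).trans ?_
  rw [intervalIntegral.integral_const_mul,
    intervalIntegral.integral_comp_sub_right (fun x => x ^ (α - 1)), sub_self,
    integral_rpow (Or.inl (by linarith)), sub_add_cancel, Real.zero_rpow hα.ne', sub_zero,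
    mul_comm, ENNReal.ofReal_mul (div_nonneg (Real.rpow_nonneg (sub_nonneg.2 ht.2.le) _) hα.le)]
  refine mul_le_mul_left (ENNReal.ofReal_le_ofReal ?_) _
  have hT : 0 ≤ T - t := sub_nonneg.2 ht.2.le
  gcongr
  linarith

theorem lintegral_volterraKer_rpow_col_le (hα : 0 < α) (hα2 : α < 1 / 2) (hs : s ∈ Ioo 0 T) :
    ∫⁻ t, ‖volterraKer α T (fun x => x ^ (α - 1)) t s‖ₑ * ENNReal.ofReal (t ^ (-α)) ∂leb T ≤
      (T ^ α * (Real.Gamma (1 - 2 * α) * Real.Gamma α / Real.Gamma (1 - 2 * α + α))).toNNReal *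
        ENNReal.ofReal (s ^ (-α)) := by
  have hs_pos := hs.1
  have hT_pos := hs_pos.trans hs.2
  have hα' : 0 < 1 - 2 * α := by linarith
  have h_le : ∀ t, ‖volterraKer α T (fun x => x ^ (α - 1)) t s‖ₑ * ENNReal.ofReal (t ^ (-α)) ≤
      (Ioc 0 s).indicator (fun t => ENNReal.ofReal
        (s ^ α * (t ^ (1 - 2 * α - 1) * (s - t) ^ (α - 1)))) t := by
    intro t
    by_cases ht : 0 < t ∧ t < s
    · have ht_pos : 0 < t := ht.1
      have hst : 0 < s - t := sub_pos.2 ht.2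
      rw [indicator_of_mem (show t ∈ Ioc 0 s from ⟨ht.1, ht.2.le⟩),
        volterraKer_of_mem_Ioc ht.1 ⟨ht.2, hs.2.le⟩,
        Real.enorm_of_nonneg (by positivity), ← ENNReal.ofReal_mul (by positivity),
        show 1 - 2 * α - 1 = -α + -α by ring, Real.rpow_add ht_pos]
      exact le_of_eq (congrArg _ (by ring))
    · rw [volterraKer, if_neg fun h => ht ⟨h.1, h.2.1⟩]
      simp
  have hB_nonneg : 0 ≤ Real.Gamma (1 - 2 * α) * Real.Gamma α / Real.Gamma (1 - 2 * α + α) := by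
    have := Real.Gamma_pos_of_pos hα
    have := Real.Gamma_pos_of_pos hα'
    have := Real.Gamma_pos_of_pos (add_pos hα' hα)
    positivity
  have h_one_le : 1 ≤ T ^ α * s ^ (-α) := by
    rw [Real.rpow_neg hs_pos.le, ← div_eq_mul_inv, one_le_div (by positivity)]
    exact Real.rpow_le_rpow hs_pos.le hs.2.le hα.le
  refine (lintegral_mono h_le).trans ((lintegral_indicator_Ioc_leb_le hs_pos.le
    ((intervalIntegrable_rpow_mul_sub_rpow hα' hα hs_pos).const_mul _) (fun t ht => ?_) T).trans ?_)
  · have : 0 ≤ s - t := sub_nonneg.2 ht.2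
    have := ht.1
    positivity
  rw [intervalIntegral.integral_const_mul, integral_rpow_mul_sub_rpow hα' hα hs_pos, ← mul_assoc,
    ← Real.rpow_add hs_pos, show α + (1 - 2 * α + α - 1) = 0 by ring, Real.rpow_zero,
    ENNReal.ofNNReal_toNNReal, ← ENNReal.ofReal_mul (by positivity), mul_right_comm]
  exact ENNReal.ofReal_le_ofReal (mul_le_mul_of_nonneg_right h_one_le hB_nonneg)

theorem isL2Kernel_volterraKer_rpow (hα : 0 < α) (hα2 : α < 1 / 2) (T : ℝ) :
    IsL2Kernel (leb T) (volterraKer α T fun x => x ^ (α - 1)) := by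
  refine isL2Kernel_of_schur_test (measurable_volterraKer α T (by fun_prop))
    (w := fun s => ENNReal.ofReal (s ^ (-α))) (by fun_prop) ?_ _ _
    ((ae_leb_mem_Ioo T).mono fun t ht => lintegral_volterraKer_rpow_row_le hα ht)
    ((ae_leb_mem_Ioo T).mono fun s hs => lintegral_volterraKer_rpow_col_le hα hα2 hs)
  filter_upwards [ae_leb_mem_Ioo T] with s hs
  exact ⟨by simpa using Real.rpow_pos_of_pos hs.1 _, ENNReal.ofReal_ne_top⟩

theorem isL2Kernel_volterraKer (hα : 0 < α) (hα2 : α < 1 / 2) {θ : ℝ → ℝ}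
    (hθ : IsWeaklySingular α T θ) : IsL2Kernel (leb T) (volterraKer α T θ) := by
  obtain ⟨M, hM⟩ := hθ.bound
  exact ((isL2Kernel_volterraKer_rpow hα hα2 T).const_mul M).of_abs_le
    (measurable_volterraKer α T hθ.measurable) (abs_volterraKer_le hM)

end SchurTest

section Integrals

variable {α T t s : ℝ} {θ : ℝ → ℝ}

theorem integral_volterraKer_mul (ht : 0 < t) (htT : t ≤ T) (f : ℝ → ℝ) :
    ∫ s, volterraKer α T θ t s * f s ∂leb T =
      ∫ s in t..T, t ^ (-α) * s ^ α * θ (s - t) * f s := by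
  simp only [volterraKer_mul_eq_indicator ht]
  rw [integral_indicator measurableSet_Ioc, leb_restrict_Ioc ht.le,
    intervalIntegral.integral_of_le htT]

theorem volterraKer_mul_eq_zero_of_notMem_Icc (f : ℝ → ℝ) (hs : s ∉ Icc 0 T) :
    volterraKer α T θ t s * f s = 0 := by
  rcases lt_or_ge 0 t with ht | ht
  · rw [volterraKer_of_notMem_Ioc fun h => hs ⟨(ht.trans h.1).le, h.2⟩, zero_mul]
  · rw [volterraKer_of_nonpos ht, zero_mul]

theorem integral_volterraKer_mul_leb (f : ℝ → ℝ) :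
    ∫ s, volterraKer α T θ t s * f s ∂leb T = ∫ s, volterraKer α T θ t s * f s :=
  setIntegral_eq_integral_of_forall_compl_eq_zero fun _ => volterraKer_mul_eq_zero_of_notMem_Icc f

theorem integrable_volterraKer_mul_leb_iff {f : ℝ → ℝ} :
    Integrable (fun s => volterraKer α T θ t s * f s) (leb T) ↔
      Integrable fun s => volterraKer α T θ t s * f s :=
  integrableOn_iff_integrable_of_support_subset
    (Function.support_subset_iff'.2 fun _ => volterraKer_mul_eq_zero_of_notMem_Icc f)

theorem integrable_volterraKer_mul_iff (ht : 0 < t) (htT : t ≤ T) {f : ℝ → ℝ} :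
    Integrable (fun s => volterraKer α T θ t s * f s) (leb T) ↔
      IntervalIntegrable (fun s => t ^ (-α) * s ^ α * θ (s - t) * f s) volume t T := by
  simp only [volterraKer_mul_eq_indicator ht]
  rw [integrable_indicator_iff measurableSet_Ioc, IntegrableOn, leb_restrict_Ioc ht.le,
    intervalIntegrable_iff_integrableOn_Ioc_of_le htT, IntegrableOn]

theorem integrable_volterraKer_rpow (hα : 0 < α) (T t : ℝ) :
    Integrable (volterraKer α T (fun x => x ^ (α - 1)) t) := by
  rcases le_or_gt t 0 with ht | ht
  · exact (integrable_zero ℝ ℝ volume).congr (.of_forall fun s => (volterraKer_of_nonpos ht s).symm)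
  · rw [funext (volterraKer_eq_indicator ht), integrable_indicator_iff measurableSet_Ioc]
    rcases le_total t T with htT | hTt
    · have h_cont : ContinuousOn (fun s : ℝ => t ^ (-α) * s ^ α) (uIcc t T) := by
        refine continuousOn_const.mul (continuousOn_id.rpow_const fun s hs => Or.inl ?_)
        rw [uIcc_of_le htT] at hs
        exact (ht.trans_le hs.1).ne'
      exact (intervalIntegrable_iff_integrableOn_Ioc_of_le htT).1
        ((intervalIntegrable_sub_rpow hα t T).continuousOn_mul h_cont)
    · rw [Ioc_eq_empty hTt.not_gt]
      exact integrableOn_empty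

theorem integrable_volterraKer (hα : 0 < α) (hθ : IsWeaklySingular α T θ) (t : ℝ) :
    Integrable (volterraKer α T θ t) := by
  obtain ⟨M, hM⟩ := hθ.bound
  exact ((integrable_volterraKer_rpow hα T t).const_mul M).mono'
    ((measurable_volterraKer α T hθ.measurable).comp measurable_prodMk_left).aestronglyMeasurable
    (Filter.Eventually.of_forall (abs_volterraKer_le hM t))

theorem volterraKer_mul_volterraKer (α T : ℝ) (θ₁ θ₂ : ℝ → ℝ) (t u s : ℝ) :
    volterraKer α T θ₁ t u * volterraKer α T θ₂ u s =
      (Ioo t s).indicator (fun u => volterraKer α T (fun _ => θ₁ (u - t) * θ₂ (s - u)) t s) u := by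
  by_cases hu : u ∈ Ioo t s
  · rw [indicator_of_mem hu]
    by_cases h : 0 < t ∧ s ≤ T
    · have hu_pos : 0 < u := h.1.trans hu.1
      have h_cancel : u ^ α * u ^ (-α) = 1 := by rw [← Real.rpow_add hu_pos]; simp
      rw [volterraKer_of_mem_Ioc h.1 ⟨hu.1, hu.2.le.trans h.2⟩,
        volterraKer_of_mem_Ioc hu_pos ⟨hu.2, h.2⟩,
        volterraKer_of_mem_Ioc h.1 ⟨hu.1.trans hu.2, h.2⟩]
      linear_combination (t ^ (-α) * s ^ α * (θ₁ (u - t) * θ₂ (s - u))) * h_cancel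
    · unfold volterraKer
      grind
  · rw [indicator_of_notMem hu]
    unfold volterraKer
    grind

theorem integral_volterraKer_mul_volterraKer (α T : ℝ) (θ₁ θ₂ : ℝ → ℝ) (t s : ℝ) :
    ∫ u, volterraKer α T θ₁ t u * volterraKer α T θ₂ u s ∂leb T =
      volterraKer α T (volterraConv θ₁ θ₂) t s := by
  simp only [volterraKer_mul_volterraKer]
  by_cases h : 0 < t ∧ t < s ∧ s ≤ T
  · have h_inter : Ioo t s ∩ Icc 0 T = Ioo t s :=
      inter_eq_left.2 fun u hu => ⟨h.1.le.trans hu.1.le, hu.2.le.trans h.2.2⟩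
    have h_shift := intervalIntegral.integral_comp_sub_right (a := t) (b := s)
      (fun v => θ₁ v * θ₂ (s - t - v)) t
    simp only [sub_self, sub_sub_sub_cancel_right] at h_shift
    simp only [volterraKer_of_mem_Ioc h.1 h.2]
    rw [integral_indicator measurableSet_Ioo, Measure.restrict_restrict measurableSet_Ioo, h_inter,
      ← integral_Ioc_eq_integral_Ioo, ← intervalIntegral.integral_of_le h.2.1.le,
      intervalIntegral.integral_const_mul, h_shift, volterraConv]
  · simp [volterraKer, h]

end Integrals

/-! ### Stieltjes measures with a jump and an absolutely continuous part -/

section Stieltjes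

open Filter Topology

theorem boundedVariationOn_of_dist_le_sub {α E : Type*} [LinearOrder α] [PseudoMetricSpace E]
    {f : α → E} {G : α → ℝ} {s : Set α} (hG : BoundedVariationOn G s)
    (h : ∀ x ∈ s, ∀ y ∈ s, x ≤ y → dist (f y) (f x) ≤ G y - G x) : BoundedVariationOn f s := by
  refine ne_top_of_le_ne_top hG (iSup_mono fun p => Finset.sum_le_sum fun i _ => ?_)
  rw [edist_dist, edist_dist, Real.dist_eq]
  exact ENNReal.ofReal_le_ofReal
    ((h _ (p.2.2.2 i) _ (p.2.2.2 (i + 1)) (p.2.2.1 i.le_succ)).trans (le_abs_self _))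

variable (ν : SignedMeasure ℝ)

theorem boundedVariationOn_apply_Iio : BoundedVariationOn (fun s => ν (Iio s)) univ := by
  refine boundedVariationOn_of_dist_le_sub (G := fun s => ν.totalVariation.real (Iio s)) ?_ ?_
  · refine MonotoneOn.boundedVariationOn (C := ν.totalVariation.real univ) ?_ ?_
    · exact fun x _ y _ hxy => measureReal_mono (Iio_subset_Iio hxy)
    · intro x _
      rw [abs_of_nonneg measureReal_nonneg]
      exact measureReal_mono (subset_univ _)
  · intro x _ y _ hxy
    rw [Real.dist_eq, ← VectorMeasure.of_sdiff measurableSet_Iio measurableSet_Iio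
      (Iio_subset_Iio hxy), ← measureReal_sdiff (Iio_subset_Iio hxy) measurableSet_Iio]
    exact ν.norm_le_totalVariation _

theorem leftLim_apply_Iio (a : ℝ) : Function.leftLim (fun s => ν (Iio s)) a = ν (Iio a) := by
  obtain ⟨u, hu_mono, hu_lt, hu_tendsto⟩ := exists_seq_strictMono_tendsto a
  have h_union : ⋃ n, Iio (u n) = Iio a := by
    refine (iUnion_subset fun n => Iio_subset_Iio (hu_lt n).le).antisymm fun x hx => ?_
    exact mem_iUnion.2 (hu_tendsto.eventually (lt_mem_nhds hx)).exists
  refine tendsto_nhds_unique (((boundedVariationOn_apply_Iio ν).tendsto_leftLim a).comp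
    (tendsto_nhdsWithin_iff.2 ⟨hu_tendsto, .of_forall hu_lt⟩)) ?_
  rw [← h_union]
  exact ν.tendsto_vectorMeasure_iUnion_atTop_nat
    (fun m n hmn => Iio_subset_Iio (hu_mono.monotone hmn)) fun _ => measurableSet_Iio

theorem limUnder_atTop_apply_Iio : limUnder atTop (fun s => ν (Iio s)) = ν univ := by
  refine tendsto_nhds_unique ((boundedVariationOn_apply_Iio ν).tendsto_atTop_limUnder.comp
    tendsto_natCast_atTop_atTop) ?_
  have h_union : ⋃ n : ℕ, Iio (n : ℝ) = univ := iUnion_eq_univ_iff.2 exists_nat_gt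
  rw [← h_union]
  exact ν.tendsto_vectorMeasure_iUnion_atTop_nat
    (fun m n hmn => Iio_subset_Iio (Nat.cast_le.2 hmn)) fun _ => measurableSet_Iio

theorem limUnder_atBot_apply_Iio : limUnder atBot (fun s => ν (Iio s)) = 0 := by
  refine tendsto_nhds_unique ((boundedVariationOn_apply_Iio ν).tendsto_atBot_limUnder.comp
    (tendsto_neg_atTop_atBot.comp tendsto_natCast_atTop_atTop)) ?_
  have h_inter : ⋂ n : ℕ, Iio (-n : ℝ) = ∅ := by
    refine eq_empty_of_forall_notMem fun x hx => ?_
    obtain ⟨n, hn⟩ := exists_nat_gt (-x)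
    exact lt_asymm (neg_lt.1 hn) (mem_iInter.1 hx n)
  rw [← ν.empty, ← h_inter]
  exact VectorMeasure.tendsto_vectorMeasure_iInter_atTop_nat
    (fun m n hmn => Iio_subset_Iio (neg_le_neg (Nat.cast_le.2 hmn))) fun _ => measurableSet_Iio

theorem vectorMeasure_apply_Iio (h : BoundedVariationOn (fun s => ν (Iio s)) univ) :
    h.vectorMeasure = ν := by
  refine VectorMeasure.ext_of_generateFrom (range Iio) ?_
    (BorelSpace.measurable_eq.trans (borel_eq_generateFrom_Iio ℝ)) isPiSystem_Iio ?_
  · rintro _ ⟨a, rfl⟩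
    rw [h.vectorMeasure_Iio, leftLim_apply_Iio, limUnder_atBot_apply_Iio, sub_zero]
  · rw [h.vectorMeasure_univ, limUnder_atTop_apply_Iio, limUnder_atBot_apply_Iio, sub_zero]

variable {ν} in
theorem stieltjes_eq {G : ℝ → ℝ} {t T : ℝ} (hG : ∀ s, G (max t (min s T)) = ν (Iio s)) :
    stieltjes G t T = ν := by
  unfold stieltjes
  rw [funext hG, dif_pos (boundedVariationOn_apply_Iio ν), vectorMeasure_apply_Iio]

end Stieltjes

section WithDensity

variable {X : Type*} [MeasurableSpace X] {μ : Measure X} {r g : X → ℝ}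

theorem integrable_toNNReal_smul (hr : AEMeasurable r μ) (hg : Integrable (fun x => r x * g x) μ) :
    Integrable (fun x => (r x).toNNReal • g x) μ := by
  refine (hg.indicator₀ (s := {x | 0 ≤ r x})
    (nullMeasurableSet_le aemeasurable_const hr)).congr (.of_forall fun x => ?_)
  by_cases hx : 0 ≤ r x
  · simp [NNReal.smul_def, hx]
  · simp [hx, Real.toNNReal_of_nonpos (not_le.1 hx).le]

theorem integrable_withDensity_ofReal (hr : AEMeasurable r μ)
    (hg : Integrable (fun x => r x * g x) μ) :
    Integrable g (μ.withDensity fun x => ENNReal.ofReal (r x)) :=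
  (integrable_withDensity_iff_integrable_smul₀ hr.real_toNNReal).2 (integrable_toNNReal_smul hr hg)

theorem integral_withDensity_ofReal (hr : AEMeasurable r μ) (g : X → ℝ) :
    ∫ x, g x ∂μ.withDensity (fun x => ENNReal.ofReal (r x)) = ∫ x, (r x).toNNReal • g x ∂μ :=
  integral_withDensity_eq_integral_smul₀ hr.real_toNNReal g

theorem integrable_and_integral_withDensityᵥ (hr : Integrable r μ)
    (hg : Integrable (fun x => r x * g x) μ) :
    (μ.withDensityᵥ r).Integrable g ∧
      (μ.withDensityᵥ r).integral g (ContinuousLinearMap.lsmul ℝ ℝ) = ∫ x, r x * g x ∂μ := by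
  have h_flip : (ContinuousLinearMap.lsmul ℝ ℝ : ℝ →L[ℝ] ℝ →L[ℝ] ℝ) =
      (ContinuousLinearMap.lsmul ℝ ℝ : ℝ →L[ℝ] ℝ →L[ℝ] ℝ).flip := by
    ext
    simp
  have hg_neg : Integrable (fun x => -r x * g x) μ := by simpa only [neg_mul] using! hg.neg
  have hr_meas := hr.aemeasurable
  have := isFiniteMeasure_withDensity_ofReal hr.2
  have := isFiniteMeasure_withDensity_ofReal hr.neg.2
  have h_pos : (μ.withDensity fun x => ENNReal.ofReal (r x)).toSignedMeasure.Integrable g := by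
    rw [VectorMeasure.Integrable, Measure.variation_toSignedMeasure]
    exact integrable_withDensity_ofReal hr_meas hg
  have h_neg : (μ.withDensity fun x => ENNReal.ofReal (-r x)).toSignedMeasure.Integrable g := by
    rw [VectorMeasure.Integrable, Measure.variation_toSignedMeasure]
    exact integrable_withDensity_ofReal hr_meas.fun_neg hg_neg
  rw [withDensityᵥ_eq_withDensity_pos_part_sub_withDensity_neg_part hr]
  refine ⟨h_pos.sub_vectorMeasure h_neg, ?_⟩
  rw [VectorMeasure.integral_sub_vectorMeasure h_pos h_neg, h_flip,
    VectorMeasure.integral_toSignedMeasure, VectorMeasure.integral_toSignedMeasure,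
    integral_withDensity_ofReal hr_meas, integral_withDensity_ofReal hr_meas.fun_neg, ← integral_sub
      (integrable_toNNReal_smul hr_meas hg) (integrable_toNNReal_smul hr_meas.fun_neg hg_neg)]
  congr 1 with x
  simp only [NNReal.smul_def, smul_eq_mul, ← sub_mul, Real.coe_toNNReal',
    max_zero_sub_max_neg_zero_eq_self]

theorem restrict_withDensityᵥ_eq_self (hr : Integrable r μ) {S : Set X} (hS : MeasurableSet S)
    (h_supp : ∀ x ∉ S, r x = 0) : (μ.withDensityᵥ r).restrict S = μ.withDensityᵥ r := by
  ext E hE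
  rw [VectorMeasure.restrict_apply _ hS hE, withDensityᵥ_apply hr (hE.inter hS),
    withDensityᵥ_apply hr hE]
  exact (setIntegral_eq_of_subset_of_forall_sdiff_eq_zero hE inter_subset_left
    fun x hx => h_supp x fun hx' => hx.2 ⟨hx.1, hx'⟩).symm

end WithDensity

section Jump

variable {c t : ℝ} {r g : ℝ → ℝ}

theorem dirac_add_withDensityᵥ_Iio (hr : Integrable r) (s : ℝ) :
    (VectorMeasure.dirac t c + volume.withDensityᵥ r) (Iio s) =
      (Iio s).indicator (fun _ => c) t + ∫ u in Iio s, r u := by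
  rw [_root_.add_apply, withDensityᵥ_apply hr measurableSet_Iio]
  by_cases ht : t ∈ Iio s
  · rw [VectorMeasure.dirac_apply_of_mem measurableSet_Iio ht, indicator_of_mem ht]
  · rw [VectorMeasure.dirac_apply_of_notMem ht, indicator_of_notMem ht]

theorem integrable_and_integral_dirac_add_withDensityᵥ (hr : Integrable r)
    (hg : Integrable fun s => r s * g s) :
    (VectorMeasure.dirac t c + volume.withDensityᵥ r).Integrable g ∧
      (VectorMeasure.dirac t c + volume.withDensityᵥ r).integral g
        (ContinuousLinearMap.lsmul ℝ ℝ) = c * g t + ∫ s, r s * g s := by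
  have h_dirac : (VectorMeasure.dirac t c).Integrable g := by
    rw [VectorMeasure.Integrable, VectorMeasure.variation_dirac]
    exact (integrable_dirac (by simp)).smul_measure (by simp)
  obtain ⟨h_density, h_integral⟩ := integrable_and_integral_withDensityᵥ hr hg
  refine ⟨h_dirac.add_vectorMeasure h_density, ?_⟩
  rw [VectorMeasure.integral_add_vectorMeasure h_dirac h_density, VectorMeasure.integral_dirac,
    h_integral, ContinuousLinearMap.lsmul_apply, smul_eq_mul, mul_comm c]

theorem restrict_dirac_add_withDensityᵥ (hr : Integrable r) {S : Set ℝ} (hS : MeasurableSet S)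
    (ht : t ∈ S) (h_supp : ∀ s ∉ S, r s = 0) :
    (VectorMeasure.dirac t c + volume.withDensityᵥ r).restrict S =
      VectorMeasure.dirac t c + volume.withDensityᵥ r := by
  rw [VectorMeasure.restrict_add, VectorMeasure.restrict_dirac_of_mem hS ht,
    restrict_withDensityᵥ_eq_self hr hS h_supp]

theorem setIntegral_Iio_max_min {T : ℝ} (h_supp : ∀ u ∉ Ioc t T, r u = 0) (s : ℝ) :
    ∫ u in Iio (max t (min s T)), r u = ∫ u in Iio s, r u := by
  rw [← integral_Iic_eq_integral_Iio, ← integral_Iic_eq_integral_Iio,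
    ← integral_indicator measurableSet_Iic, ← integral_indicator measurableSet_Iic]
  congr 1 with u
  by_cases hu : u ∈ Ioc t T
  · have h_mem : u ∈ Iic (max t (min s T)) ↔ u ∈ Iic s := by
      simp only [mem_Iic, le_max_iff, le_min_iff, hu.2, and_true, not_le.2 hu.1, false_or]
    simp only [indicator_apply, h_mem]
  · simp only [indicator_apply, h_supp u hu, ite_self]

theorem stieltjes_eq_dirac_add_withDensityᵥ {T : ℝ} {G : ℝ → ℝ} (hr : Integrable r) (htT : t < T)
    (h_supp : ∀ u ∉ Ioc t T, r u = 0)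
    (hG : ∀ s ≤ T, G s = (VectorMeasure.dirac t c + volume.withDensityᵥ r) (Iio s)) :
    stieltjes G t T = VectorMeasure.dirac t c + volume.withDensityᵥ r := by
  refine stieltjes_eq fun s => ?_
  have h_mem : t ∈ Iio (max t (min s T)) ↔ t ∈ Iio s := by
    simp only [mem_Iio, lt_max_iff, lt_irrefl, lt_min_iff, htT, and_true, false_or]
  rw [hG _ (max_le htT.le (min_le_right _ _)), dirac_add_withDensityᵥ_Iio hr,
    dirac_add_withDensityᵥ_Iio hr, setIntegral_Iio_max_min h_supp]
  simp only [indicator_apply, h_mem]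

end Jump

/-! ### The kernels `K_H` and `L⁻¹` as primitives of Volterra kernels -/

/-- The parameter `κ = c(H) Γ(H - 1/2)` for which `∂_s K_H(s, t)` is the Volterra kernel with
profile `abelPow (H - 1/2) κ 1`. -/
def kernelParam (H : ℝ) : ℝ := cH H * Real.Gamma (H - 1 / 2)

/-- The parameter `-(b / a) κ` of the Volterra kernel subtracted from the identity in
`L^* = a (id - V)`. -/
def resolventParam (a b H : ℝ) : ℝ := -(b / a) * kernelParam H

/-- The signed measure `L⁻¹(ds, t)` on `(-∞, T]`: an atom at `t` plus a density which is, up to the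
factor `1 / a`, the resolvent kernel. -/
def LinvMeasure (a b H T t : ℝ) : SignedMeasure ℝ :=
  VectorMeasure.dirac t (1 / a) + volume.withDensityᵥ fun s => 1 / a *
    volterraKer (H - 1 / 2) T (abelResolvent (H - 1 / 2) (resolventParam a b H)) t s

theorem setIntegral_Iio_volterraKer {α T s t : ℝ} (θ : ℝ → ℝ) (hs : 0 < s) (hst : s ≤ t)
    (htT : t ≤ T) :
    ∫ u in Iio t, volterraKer α T θ s u = ∫ u in s..t, s ^ (-α) * u ^ α * θ (u - s) := by
  have h_inter : Iio t ∩ Ioc s T = Ioo s t := by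
    ext u
    simp only [mem_inter_iff, mem_Iio, mem_Ioc, mem_Ioo]
    exact ⟨fun h => ⟨h.2.1, h.1⟩, fun h => ⟨h.2, h.1, h.2.le.trans htT⟩⟩
  simp only [volterraKer_eq_indicator hs]
  rw [setIntegral_indicator measurableSet_Ioc, h_inter, ← integral_Ioc_eq_integral_Ioo,
    intervalIntegral.integral_of_le hst]

theorem setIntegral_Iio_volterraKer_of_le {α T s t : ℝ} (θ : ℝ → ℝ) (hts : t ≤ s) :
    ∫ u in Iio t, volterraKer α T θ s u = 0 :=
  setIntegral_eq_zero_of_forall_eq_zero fun _ hu =>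
    volterraKer_of_notMem_Ioc fun hu' => hu'.1.not_ge (le_trans (le_of_lt hu) hts)

theorem tsum_volterraKer_abelPow_succ (α z T s u : ℝ) :
    ∑' k : ℕ, volterraKer α T (abelPow α z (k + 1)) s u =
      volterraKer α T (abelResolvent α z) s u := by
  simp only [volterraKer]
  split_ifs
  · rw [tsum_mul_left, abelResolvent]
  · exact tsum_zero

theorem hasSum_setIntegral_volterraKer_abelPow_succ {α : ℝ} (hα : 0 < α) (z : ℝ) {T : ℝ}
    (hT : 0 < T) (s : ℝ) (E : Set ℝ) :
    HasSum (fun k : ℕ => ∫ u in E, volterraKer α T (abelPow α z (k + 1)) s u)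
      (∫ u in E, volterraKer α T (abelResolvent α z) s u) := by
  have h_int (k : ℕ) : Integrable (volterraKer α T (abelPow α z (k + 1)) s) :=
    integrable_volterraKer hα (isWeaklySingular_abelPow_succ hα T z k) s
  have h_sum : Summable fun k : ℕ =>
      ∫ u in E, ‖volterraKer α T (abelPow α z (k + 1)) s u‖ := by
    refine Summable.of_nonneg_of_le (fun k => integral_nonneg fun u => norm_nonneg _) (fun k => ?_)
      ((((summable_nat_add_iff 1).2 (summable_abelPow hα |z| hT)).mul_right (T ^ (1 - α))).mul_right
        (∫ u in E, volterraKer α T (fun x => x ^ (α - 1)) s u))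
    rw [← integral_const_mul]
    exact integral_mono (h_int k).norm.integrableOn
      ((integrable_volterraKer_rpow hα T s).const_mul _).integrableOn
      (abs_volterraKer_le (fun x hx => abs_abelPow_succ_le hα z hx k) s)
  simpa only [tsum_volterraKer_abelPow_succ] using
    hasSum_integral_of_summable_integral_norm (fun k => (h_int k).integrableOn) h_sum

section Kernels

variable {H : ℝ}

theorem gam_eq_setIntegral (hH : 1 / 2 < H) (k : ℕ) {s t T : ℝ} (hs : 0 ≤ s) (htT : t ≤ T) :
    gam H k t s =
      ∫ u in Iio t, volterraKer (H - 1 / 2) T (abelPow (H - 1 / 2) (kernelParam H) k) s u := by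
  unfold gam
  split_ifs with hst
  · rcases hs.eq_or_lt with rfl | hs_pos
    · rw [Real.zero_rpow (sub_pos.2 hH).ne']
      simp only [div_zero, mul_zero, zero_mul, volterraKer_of_nonpos le_rfl, integral_zero]
    · rw [setIntegral_Iio_volterraKer _ hs_pos hst.le htT, ← intervalIntegral.integral_const_mul]
      refine intervalIntegral.integral_congr fun u _ => ?_
      simp only [abelPow, kernelParam, mul_pow, Real.rpow_neg hs]
      ring
  · rw [setIntegral_Iio_volterraKer_of_le _ (not_lt.1 hst)]

theorem gam_one (hH : 1 / 2 < H) (t s : ℝ) : gam H 1 t s = KH H t s := by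
  unfold gam KH
  split_ifs with hst
  · have hΓ : Real.Gamma (H - 1 / 2) ≠ 0 := (Real.Gamma_pos_of_pos (by linarith)).ne'
    rw [pow_one, pow_one, Nat.cast_one, one_mul, mul_div_cancel_right₀ _ hΓ]
    congr 1
    refine intervalIntegral.integral_congr fun u hu => ?_
    rw [uIcc_of_le hst.le] at hu
    simp only [div_eq_mul_inv, ← Real.rpow_neg (sub_nonneg.2 hu.1)]
    ring_nf
  · rfl

theorem KH_eq_setIntegral (hH : 1 / 2 < H) {s t T : ℝ} (hs : 0 ≤ s) (htT : t ≤ T) :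
    KH H t s =
      ∫ u in Iio t, volterraKer (H - 1 / 2) T (abelPow (H - 1 / 2) (kernelParam H) 1) s u := by
  rw [← gam_one hH, gam_eq_setIntegral hH 1 hs htT]

theorem deriv_KH (hH : 1 / 2 < H) {t s : ℝ} (ht : 0 < t) (hts : t < s) :
    deriv (fun u => KH H u t) s = t ^ (-(H - 1 / 2)) * s ^ (H - 1 / 2) *
      abelPow (H - 1 / 2) (kernelParam H) 1 (s - t) := by
  set α := H - 1 / 2
  have hα : 0 < α := sub_pos.2 hH
  set φ : ℝ → ℝ := fun u => t ^ (-α) * u ^ α * abelPow α (kernelParam H) 1 (u - t)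
  have h_int : IntervalIntegrable φ volume t s := by
    simpa using (integrable_volterraKer_mul_iff ht hts.le (f := fun _ => 1)).1 (by
      simpa using (integrable_volterraKer hα
        (isWeaklySingular_abelPow_one hα s (kernelParam H)) t).restrict)
  have h_cont : ContinuousAt φ s := by
    have h_pow : ContinuousAt (fun u : ℝ => u ^ α) s :=
      Real.continuousAt_rpow_const _ _ (Or.inl (ht.trans hts).ne')
    have h_sub_pow : ContinuousAt (fun u : ℝ => (u - t) ^ (((1 : ℕ) : ℝ) * α - 1)) s :=
      (continuousAt_id.sub continuousAt_const).rpow_const (Or.inl (sub_pos.2 hts).ne')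
    exact (continuousAt_const.mul h_pow).mul (continuousAt_const.mul h_sub_pow)
  have h_eq : (fun u => KH H u t) =ᶠ[nhds s] fun u => ∫ v in t..u, φ v := by
    filter_upwards [Ioi_mem_nhds hts] with u hu
    rw [KH_eq_setIntegral hH ht.le le_rfl,
      setIntegral_Iio_volterraKer _ ht (le_of_lt hu) le_rfl]
  have h_meas : Measurable φ := by fun_prop
  rw [h_eq.deriv_eq, (intervalIntegral.integral_hasDerivAt_right h_int
    h_meas.stronglyMeasurable.stronglyMeasurableAtFilter h_cont).deriv]

theorem hasSum_LinvTerm (a b : ℝ) (hH : 1 / 2 < H) {s t T : ℝ} (hs : 0 ≤ s) (htT : t ≤ T)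
    (hT : 0 < T) :
    HasSum (fun k : ℕ => LinvTerm a b H t s (k + 1)) (∫ u in Iio t,
      volterraKer (H - 1 / 2) T (abelResolvent (H - 1 / 2) (resolventParam a b H)) s u) := by
  refine (hasSum_setIntegral_volterraKer_abelPow_succ (sub_pos.2 hH) (resolventParam a b H) hT s
    (Iio t)).congr_fun fun k => ?_
  simp only [LinvTerm, resolventParam, volterraKer_abelPow_mul, integral_const_mul,
    gam_eq_setIntegral hH _ hs htT]
  rw [neg_pow (b / a)]

theorem summable_LinvTerm (a b : ℝ) (hH : 1 / 2 < H) {s : ℝ} (hs : 0 ≤ s) (t : ℝ) :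
    Summable fun k : ℕ => LinvTerm a b H t s (k + 1) :=
  (hasSum_LinvTerm a b hH hs (le_max_left t 1) (by positivity)).summable

theorem ind_eq_indicator_Iio {s : ℝ} (hs : 0 ≤ s) (t : ℝ) :
    ind t s = (Iio t).indicator (fun _ => 1) s := by
  simp only [ind, indicator_apply, mem_Ico, mem_Iio, hs, true_and]

theorem integrable_const_mul_volterraKer_abelResolvent {α : ℝ} (hα : 0 < α) (c z T s : ℝ) :
    Integrable fun u => c * volterraKer α T (abelResolvent α z) s u :=
  (integrable_volterraKer hα (isWeaklySingular_abelResolvent hα T z) s).const_mul c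

theorem Linv_eq_LinvMeasure_Iio (a b : ℝ) (hH : 1 / 2 < H) {s t T : ℝ} (hs : 0 ≤ s) (htT : t ≤ T)
    (hT : 0 < T) : Linv a b H t s = LinvMeasure a b H T s (Iio t) := by
  rw [LinvMeasure, dirac_add_withDensityᵥ_Iio
    (integrable_const_mul_volterraKer_abelResolvent (sub_pos.2 hH) _ _ _ _), Linv,
    (hasSum_LinvTerm a b hH hs htT hT).tsum_eq, integral_const_mul, ind_eq_indicator_Iio hs,
    ← indicator_const_mul, mul_one]

theorem boundedVariationOn_Linv (a b : ℝ) (hH : 1 / 2 < H) {s T : ℝ} (hs : 0 ≤ s) (hT : 0 < T) :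
    BoundedVariationOn (fun t => Linv a b H t s) (Iic T) := by
  have h_eq : EqOn (fun t => Linv a b H t s) (fun t => LinvMeasure a b H T s (Iio t)) (Iic T) :=
    fun t ht => Linv_eq_LinvMeasure_Iio a b hH hs ht hT
  rw [BoundedVariationOn, eVariationOn.congr h_eq]
  exact (boundedVariationOn_apply_Iio _).mono (subset_univ _)

theorem stieltjes_Linv (a b : ℝ) (hH : 1 / 2 < H) {t T : ℝ} (ht : 0 ≤ t) (htT : t < T) :
    stieltjes (fun s => Linv a b H s t) t T = LinvMeasure a b H T t :=
  stieltjes_eq_dirac_add_withDensityᵥ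
    (integrable_const_mul_volterraKer_abelResolvent (sub_pos.2 hH) _ _ _ _) htT
    (fun u hu => by rw [volterraKer_of_notMem_Ioc hu, mul_zero])
    fun s hs => Linv_eq_LinvMeasure_Iio a b hH ht hs (ht.trans_lt htT)

theorem restrict_LinvMeasure (a b : ℝ) (hH : 1 / 2 < H) {t T : ℝ} (htT : t ≤ T) :
    (LinvMeasure a b H T t).restrict (Icc t T) = LinvMeasure a b H T t :=
  restrict_dirac_add_withDensityᵥ
    (integrable_const_mul_volterraKer_abelResolvent (sub_pos.2 hH) _ _ _ _) measurableSet_Icc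
    ⟨le_rfl, htT⟩ fun s hs => by
      rw [volterraKer_of_notMem_Ioc fun hs' => hs (Ioc_subset_Icc_self hs'), mul_zero]

theorem Linv_right (a b : ℝ) (hH : 1 / 2 < H) {t T : ℝ} (ht : 0 ≤ t) (htT : t < T) :
    Linv a b H T t = 1 / a + 1 / a *
      ∫ s, volterraKer (H - 1 / 2) T (abelResolvent (H - 1 / 2) (resolventParam a b H)) t s := by
  rw [Linv, (hasSum_LinvTerm a b hH ht le_rfl (ht.trans_lt htT)).tsum_eq, ind_eq_indicator_Iio ht,
    indicator_of_mem (mem_Iio.2 htT), mul_one, ← integral_Iic_eq_integral_Iio]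
  congr 2
  exact setIntegral_eq_integral_of_forall_compl_eq_zero fun s hs =>
    volterraKer_of_notMem_Ioc fun hs' => hs hs'.2

theorem integrable_volterraKer_abelResolvent_mul_sub {α : ℝ} (hα : 0 < α) {z t T : ℝ} {f : ℝ → ℝ}
    (hf : Integrable fun s => volterraKer α T (abelResolvent α z) t s * f s) (y : ℝ) :
    Integrable fun s => volterraKer α T (abelResolvent α z) t s * (f s - y) := by
  simp only [mul_sub]
  exact hf.sub ((integrable_volterraKer hα (isWeaklySingular_abelResolvent hα T z) t).mul_const y)

theorem integrable_and_integral_LinvMeasure (a b : ℝ) (hH : 1 / 2 < H) {t T : ℝ} {g : ℝ → ℝ}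
    (hg : Integrable fun s => volterraKer (H - 1 / 2) T
      (abelResolvent (H - 1 / 2) (resolventParam a b H)) t s * g s) :
    (LinvMeasure a b H T t).Integrable g ∧
      (LinvMeasure a b H T t).integral g (ContinuousLinearMap.lsmul ℝ ℝ) =
        1 / a * g t + 1 / a * ∫ s, volterraKer (H - 1 / 2) T
          (abelResolvent (H - 1 / 2) (resolventParam a b H)) t s * g s := by
  rw [← integral_const_mul]
  simp only [← mul_assoc]
  exact integrable_and_integral_dirac_add_withDensityᵥ
    (integrable_const_mul_volterraKer_abelResolvent (sub_pos.2 hH) _ _ _ _)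
    (by simpa only [mul_assoc] using hg.const_mul (1 / a))

theorem integrableOn_stieltjes_Linv (a b : ℝ) (hH : 1 / 2 < H) {t T : ℝ} (ht : 0 ≤ t) (htT : t < T)
    {f : ℝ → ℝ} (hf : Integrable (fun s => volterraKer (H - 1 / 2) T
      (abelResolvent (H - 1 / 2) (resolventParam a b H)) t s * f s) (leb T)) :
    (stieltjes (fun s => Linv a b H s t) t T).IntegrableOn (fun s => f s - f t) (Icc t T) := by
  rw [VectorMeasure.IntegrableOn, stieltjes_Linv a b hH ht htT, restrict_LinvMeasure a b hH htT.le]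
  exact (integrable_and_integral_LinvMeasure a b hH (integrable_volterraKer_abelResolvent_mul_sub
    (sub_pos.2 hH) (integrable_volterraKer_mul_leb_iff.1 hf) (f t))).1

theorem LstarInv_eq (a b : ℝ) (hH : 1 / 2 < H) {t T : ℝ} (ht : 0 ≤ t) (htT : t < T)
    {f : ℝ → ℝ} (hf : Integrable (fun s => volterraKer (H - 1 / 2) T
      (abelResolvent (H - 1 / 2) (resolventParam a b H)) t s * f s) (leb T)) :
    LstarInv a b H T f t = 1 / a * (f t + ∫ s, volterraKer (H - 1 / 2) T
      (abelResolvent (H - 1 / 2) (resolventParam a b H)) t s * f s ∂leb T) := by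
  have hα : 0 < H - 1 / 2 := sub_pos.2 hH
  rw [integral_volterraKer_mul_leb]
  rw [integrable_volterraKer_mul_leb_iff] at hf
  rw [LstarInv, stieltjes_Linv a b hH ht htT, restrict_LinvMeasure a b hH htT.le,
    (integrable_and_integral_LinvMeasure a b hH
      (integrable_volterraKer_abelResolvent_mul_sub hα hf (f t))).2, Linv_right a b hH ht htT]
  simp only [mul_sub]
  rw [integral_sub hf ((integrable_volterraKer hα
    (isWeaklySingular_abelResolvent hα T _) t).mul_const _), integral_mul_const]
  ring

theorem mul_deriv_KH_eq (b : ℝ) {a : ℝ} (ha : a ≠ 0) (hH : 1 / 2 < H) {t s : ℝ} (ht : 0 < t)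
    (hts : t < s) :
    b * deriv (fun u => KH H u t) s = -a * (t ^ (-(H - 1 / 2)) * s ^ (H - 1 / 2) *
      abelPow (H - 1 / 2) (resolventParam a b H) 1 (s - t)) := by
  rw [deriv_KH hH ht hts, resolventParam, abelPow_mul_left]
  field_simp

theorem intervalIntegrable_mul_deriv_KH (hH : 1 / 2 < H) {t T : ℝ} (ht : 0 < t) (htT : t ≤ T)
    {f : ℝ → ℝ} (hf : Integrable (fun s => volterraKer (H - 1 / 2) T
      (abelPow (H - 1 / 2) (kernelParam H) 1) t s * f s) (leb T)) :
    IntervalIntegrable (fun s => f s * deriv (fun u => KH H u t) s) volume t T := by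
  refine ((integrable_volterraKer_mul_iff ht htT).1 hf).congr fun s hs => ?_
  rw [uIoc_of_le htT] at hs
  rw [deriv_KH hH ht hs.1, mul_comm]

theorem Lstar_eq (b : ℝ) {a : ℝ} (ha : a ≠ 0) (hH : 1 / 2 < H) {t T : ℝ} (ht : 0 < t) (htT : t ≤ T)
    (f : ℝ → ℝ) : Lstar a b H T f t = a * (f t - ∫ s, volterraKer (H - 1 / 2) T
      (abelPow (H - 1 / 2) (resolventParam a b H) 1) t s * f s ∂leb T) := by
  rw [Lstar, integral_volterraKer_mul ht htT, mul_sub, sub_eq_add_neg, ← neg_mul,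
    ← intervalIntegral.integral_const_mul, ← intervalIntegral.integral_const_mul]
  congr 1
  refine intervalIntegral.integral_congr_ae (Filter.Eventually.of_forall fun s hs => ?_)
  rw [uIoc_of_le htT] at hs
  rw [mul_left_comm, mul_deriv_KH_eq b ha hH ht hs.1]
  ring

theorem integral_volterraKer_mul_ind {α T : ℝ} (θ : ℝ → ℝ) (s t : ℝ) :
    ∫ u, volterraKer α T θ s u * ind t u ∂leb T = ∫ u in Iio t, volterraKer α T θ s u := by
  rw [integral_volterraKer_mul_leb, ← integral_indicator measurableSet_Iio]
  congr 1 with u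
  by_cases hu : u ∈ Icc 0 T
  · rw [ind_eq_indicator_Iio hu.1]
    simp only [indicator_apply, mul_ite, mul_one, mul_zero]
  · have h_zero : volterraKer α T θ s u = 0 := by
      simpa using volterraKer_mul_eq_zero_of_notMem_Icc (fun _ => 1) hu
    simp only [indicator_apply, h_zero, zero_mul, ite_self]

end Kernels

/-! ### The operator `L^*` -/

theorem op_comp_volterraKer {α T : ℝ} {θ₁ θ₂ θ₃ θ₄ : ℝ → ℝ}
    (h₁ : IsL2Kernel (leb T) (volterraKer α T θ₁)) (h₂ : IsL2Kernel (leb T) (volterraKer α T θ₂))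
    (h₃ : IsL2Kernel (leb T) (volterraKer α T θ₃)) (h₄ : IsL2Kernel (leb T) (volterraKer α T θ₄))
    (h : ∀ x, 0 < x → volterraConv θ₁ θ₂ x = θ₃ x - θ₄ x) (f : L2 T) :
    h₁.op (h₂.op f) = h₃.op f - h₄.op f := by
  refine Lp.ext ?_
  filter_upwards [h₁.op_comp_ae_eq h₂ f, Lp.coeFn_sub (h₃.op f) (h₄.op f), h₃.op_ae_eq f,
    h₄.op_ae_eq f, h₃.ae_integrable (Lp.memLp f), h₄.ae_integrable (Lp.memLp f)]
    with t h_comp h_sub h_op₃ h_op₄ h_int₃ h_int₄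
  rw [h_comp, h_sub, Pi.sub_apply, h_op₃, h_op₄, ← integral_sub h_int₃ h_int₄]
  refine integral_congr_ae (Filter.Eventually.of_forall fun s => ?_)
  simp only
  rw [integral_volterraKer_mul_volterraKer, volterraKer_congr h, volterraKer_sub, sub_mul]

section VolterraEquiv

variable {α : ℝ} (hα : 0 < α) (hα2 : α < 1 / 2) (T z : ℝ)

/-- The weighted fractional integration operator on `L²[0, T]`, with parameter `z`. -/
def abelOp : L2 T →L[ℝ] L2 T :=
  (isL2Kernel_volterraKer hα hα2 (isWeaklySingular_abelPow_one hα T z)).op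

/-- The Neumann series `∑_{k ≥ 1} V ^ k` of `V = abelOp`, as an integral operator. -/
def abelResolventOp : L2 T →L[ℝ] L2 T :=
  (isL2Kernel_volterraKer hα hα2 (isWeaklySingular_abelResolvent hα T z)).op

theorem abelOp_abelResolventOp (f : L2 T) :
    abelOp hα hα2 T z (abelResolventOp hα hα2 T z f) =
      abelResolventOp hα hα2 T z f - abelOp hα hα2 T z f :=
  op_comp_volterraKer _ _ _ _ (fun _ hx => volterraConv_abelPow_one_abelResolvent hα z hx) f

theorem abelResolventOp_abelOp (f : L2 T) :
    abelResolventOp hα hα2 T z (abelOp hα hα2 T z f) =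
      abelResolventOp hα hα2 T z f - abelOp hα hα2 T z f :=
  op_comp_volterraKer _ _ _ _ (fun x hx =>
    (volterraConv_comm _ _ x).trans (volterraConv_abelPow_one_abelResolvent hα z hx)) f

/-- The operator `id - V` with `V = abelOp`, with its Neumann series as the inverse. -/
def volterraEquiv : L2 T ≃L[ℝ] L2 T :=
  ContinuousLinearEquiv.equivOfInverse
    (ContinuousLinearMap.id ℝ _ - abelOp hα hα2 T z)
    (ContinuousLinearMap.id ℝ _ + abelResolventOp hα hα2 T z)
    (fun f => by simp [abelResolventOp_abelOp])
    (fun f => by simp [abelOp_abelResolventOp])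

variable {T}

theorem volterraEquiv_toLp_ae_eq {f : ℝ → ℝ} (hf : MemLp f 2 (leb T)) :
    volterraEquiv hα hα2 T z (hf.toLp f) =ᵐ[leb T] fun t =>
      f t - ∫ s, volterraKer α T (abelPow α z 1) t s * f s ∂leb T := by
  filter_upwards [Lp.coeFn_sub (hf.toLp f) (abelOp hα hα2 T z (hf.toLp f)), hf.coeFn_toLp,
    (isL2Kernel_volterraKer hα hα2 (isWeaklySingular_abelPow_one hα T z)).op_toLp_ae_eq hf]
    with t h_sub h_toLp h_op
  rw [← h_op, ← h_toLp]
  exact h_sub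

theorem volterraEquiv_symm_toLp_ae_eq {f : ℝ → ℝ} (hf : MemLp f 2 (leb T)) :
    (volterraEquiv hα hα2 T z).symm (hf.toLp f) =ᵐ[leb T] fun t =>
      f t + ∫ s, volterraKer α T (abelResolvent α z) t s * f s ∂leb T := by
  filter_upwards [Lp.coeFn_add (hf.toLp f) (abelResolventOp hα hα2 T z (hf.toLp f)), hf.coeFn_toLp,
    (isL2Kernel_volterraKer hα hα2 (isWeaklySingular_abelResolvent hα T z)).op_toLp_ae_eq hf]
    with t h_add h_toLp h_op
  rw [← h_op, ← h_toLp]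
  exact h_add

end VolterraEquiv

theorem ae_integrable_abelResolvent_mul {α : ℝ} (hα : 0 < α) (hα2 : α < 1 / 2) (z : ℝ) {T : ℝ}
    {f : ℝ → ℝ} (hf : MemLp f 2 (leb T)) :
    ∀ᵐ t ∂leb T, Integrable (fun s => volterraKer α T (abelResolvent α z) t s * f s) (leb T) :=
  (isL2Kernel_volterraKer hα hα2 (isWeaklySingular_abelResolvent hα T z)).ae_integrable hf

theorem memLp_ind (T t : ℝ) : MemLp (ind t) 2 (leb T) :=
  memLp_indicator_const 2 measurableSet_Ico 1
    (Or.inr ((Measure.restrict_apply_le _ _).trans_lt measure_Ico_lt_top).ne)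

theorem toLp_ind (T t : ℝ) : (memLp_ind T t).toLp (ind t) = indL2 T t := rfl

theorem sub_half_lt_half {H : ℝ} (hH : H < 1) : H - 1 / 2 < 1 / 2 := by linarith

theorem memLp_KH {H : ℝ} (hH : H ∈ Ioo (1 / 2 : ℝ) 1) {t T : ℝ} (htT : t ≤ T) :
    MemLp (KH H t) 2 (leb T) := by
  refine (memLp_congr_ae ?_).1 ((isL2Kernel_volterraKer (sub_pos.2 hH.1) (sub_half_lt_half hH.2)
    (isWeaklySingular_abelPow_one (sub_pos.2 hH.1) T (kernelParam H))).memLp_integral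
      (memLp_ind T t))
  filter_upwards [ae_leb_mem_Ioo T] with s hs
  rw [integral_volterraKer_mul_ind, KH_eq_setIntegral hH.1 hs.1.le htT]

theorem ae_intervalIntegrable_mul_deriv_KH {H : ℝ} (hH : H ∈ Ioo (1 / 2 : ℝ) 1) {T : ℝ}
    {f : ℝ → ℝ} (hf : MemLp f 2 (leb T)) :
    ∀ᵐ t ∂leb T, IntervalIntegrable (fun s => f s * deriv (fun u => KH H u t) s) volume t T := by
  have hα := sub_pos.2 hH.1
  filter_upwards [ae_leb_mem_Ioo T, (isL2Kernel_volterraKer hα (sub_half_lt_half hH.2)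
    (isWeaklySingular_abelPow_one hα T (kernelParam H))).ae_integrable hf] with t ht h_int
  exact intervalIntegrable_mul_deriv_KH hH.1 ht.1 ht.2.le h_int

theorem ae_integrableOn_stieltjes_Linv (a b : ℝ) {H : ℝ} (hH : H ∈ Ioo (1 / 2 : ℝ) 1) {T : ℝ}
    {f : ℝ → ℝ} (hf : MemLp f 2 (leb T)) :
    ∀ᵐ t ∂leb T, (stieltjes (fun s => Linv a b H s t) t T).IntegrableOn
      (fun s => f s - f t) (Icc t T) := by
  filter_upwards [ae_leb_mem_Ioo T, ae_integrable_abelResolvent_mul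
    (sub_pos.2 hH.1) (sub_half_lt_half hH.2) (resolventParam a b H) hf] with t ht h_int
  exact integrableOn_stieltjes_Linv a b hH.1 ht.1.le ht.2 h_int

section LstarEquiv

variable {a H : ℝ} (ha : a ≠ 0) (b : ℝ) (hH : H ∈ Ioo (1 / 2 : ℝ) 1) {T : ℝ} {f : ℝ → ℝ}

/-- The operator `L^* = a (id - V)` on `L²[0, T]`. -/
def LstarEquiv (T : ℝ) : L2 T ≃L[ℝ] L2 T :=
  (volterraEquiv (sub_pos.2 hH.1) (sub_half_lt_half hH.2) T (resolventParam a b H)).trans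
    (ContinuousLinearEquiv.smulLeft (Units.mk0 a ha))

theorem LstarEquiv_toLp_ae_eq (hf : MemLp f 2 (leb T)) :
    LstarEquiv ha b hH T (hf.toLp f) =ᵐ[leb T] Lstar a b H T f := by
  filter_upwards [Lp.coeFn_smul a (volterraEquiv (sub_pos.2 hH.1) (sub_half_lt_half hH.2) T
      (resolventParam a b H) (hf.toLp f)),
    volterraEquiv_toLp_ae_eq (sub_pos.2 hH.1) (sub_half_lt_half hH.2) (resolventParam a b H) hf,
    ae_leb_mem_Ioo T] with t h_smul h_equiv ht
  rw [Lstar_eq b ha hH.1 ht.1 ht.2.le, ← h_equiv]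
  exact h_smul

theorem LstarEquiv_symm_toLp_ae_eq (hf : MemLp f 2 (leb T)) :
    (LstarEquiv ha b hH T).symm (hf.toLp f) =ᵐ[leb T] LstarInv a b H T f := by
  have hα := sub_pos.2 hH.1
  have hα2 := sub_half_lt_half hH.2
  have h_symm : (LstarEquiv ha b hH T).symm (hf.toLp f) =
      (1 / a) • (volterraEquiv hα hα2 T (resolventParam a b H)).symm (hf.toLp f) := by
    rw [one_div, ← map_smul]
    rfl
  rw [h_symm]
  filter_upwards [Lp.coeFn_smul (1 / a)
      ((volterraEquiv hα hα2 T (resolventParam a b H)).symm (hf.toLp f)),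
    volterraEquiv_symm_toLp_ae_eq hα hα2 (resolventParam a b H) hf,
    ae_integrable_abelResolvent_mul hα hα2 (resolventParam a b H) hf, ae_leb_mem_Ioo T]
    with t h_smul h_equiv h_int ht
  rw [h_smul, Pi.smul_apply, h_equiv, LstarInv_eq a b hH.1 ht.1.le ht.2 h_int, smul_eq_mul]

theorem LstarEquiv_indL2_ae_eq {t : ℝ} (htT : t ≤ T) :
    LstarEquiv ha b hH T (indL2 T t) =ᵐ[leb T] Lker a b H t := by
  rw [← toLp_ind]
  filter_upwards [LstarEquiv_toLp_ae_eq ha b hH (memLp_ind T t), ae_leb_mem_Ioo T] with s h hs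
  rw [h, Lstar_eq b ha hH.1 hs.1 hs.2.le, integral_volterraKer_mul_ind, Lker,
    KH_eq_setIntegral hH.1 hs.1.le htT]
  simp only [resolventParam, volterraKer_abelPow_mul, integral_const_mul]
  field_simp
  ring

theorem LstarEquiv_symm_indL2_ae_eq {t : ℝ} (htT : t ≤ T) :
    (LstarEquiv ha b hH T).symm (indL2 T t) =ᵐ[leb T] Linv a b H t := by
  rw [← toLp_ind]
  filter_upwards [LstarEquiv_symm_toLp_ae_eq ha b hH (memLp_ind T t), ae_leb_mem_Ioo T,
    ae_integrable_abelResolvent_mul (sub_pos.2 hH.1) (sub_half_lt_half hH.2) (resolventParam a b H)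
      (memLp_ind T t)] with s h hs h_int
  rw [h, LstarInv_eq a b hH.1 hs.1.le hs.2 h_int, integral_volterraKer_mul_ind, Linv,
    (hasSum_LinvTerm a b hH.1 hs.1.le htT (hs.1.trans hs.2)).tsum_eq, mul_add]

end LstarEquiv

/-! ### The indicators are total in `L²[0, T]` -/

theorem inner_indL2 {T t s : ℝ} (ht : t ∈ Icc 0 T) (hs : s ∈ Icc 0 T) :
    inner ℝ (indL2 T t) (indL2 T s) = min t s := by
  have h_inter : Ico 0 t ∩ Ico 0 s ∩ Icc 0 T = Ico 0 (min t s) := by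
    rw [Ico_inter_Ico, max_self]
    exact inter_eq_left.2 fun x hx => ⟨hx.1, (hx.2.trans_le (min_le_left _ _)).le.trans ht.2⟩
  rw [indL2, indL2, L2.inner_indicatorConstLp_indicatorConstLp, measureReal_restrict_apply
    (measurableSet_Ico.inter measurableSet_Ico), h_inter, Real.volume_real_Ico_of_le
    (le_min ht.1 hs.1)]
  simp

theorem ae_eq_zero_of_forall_setIntegral_Iio {μ : Measure ℝ} {f : ℝ → ℝ} (hf : Integrable f μ)
    (h : ∀ v, ∫ x in Iio v, f x ∂μ = 0) : f =ᵐ[μ] 0 := by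
  have h_univ : ∫ x, f x ∂μ = 0 := by
    refine tendsto_nhds_unique
      ((aecover_Iio Filter.tendsto_id).integral_tendsto_of_countably_generated hf) ?_
    simp only [id, h, tendsto_const_nhds]
  refine hf.ae_eq_of_withDensityᵥ_eq (integrable_zero _ _ _) ?_
  rw [withDensityᵥ_zero]
  refine VectorMeasure.ext_of_generateFrom (range Iio) ?_ ?_ isPiSystem_Iio ?_
  · rintro _ ⟨v, rfl⟩
    rw [withDensityᵥ_apply hf measurableSet_Iio, h, _root_.zero_apply]
  · rw [BorelSpace.measurable_eq (α := ℝ), borel_eq_generateFrom_Iio]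
  · rw [withDensityᵥ_apply hf MeasurableSet.univ, setIntegral_univ, h_univ, _root_.zero_apply]

theorem restrict_leb_Iio (T v : ℝ) :
    (leb T).restrict (Iio v) = (leb T).restrict (Ico 0 (max 0 (min v T))) := by
  refine Measure.restrict_congr_set ?_
  filter_upwards [ae_leb_mem_Ioo T] with x hx
  refine propext (show x < v ↔ 0 ≤ x ∧ x < max 0 (min v T) from ?_)
  simp only [lt_max_iff, lt_min_iff, hx.1.le, hx.1.not_gt, hx.2, true_and, and_true, false_or]

theorem eq_zero_of_forall_inner_indL2 {T : ℝ} (hT : 0 ≤ T) {f : L2 T}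
    (h : ∀ t : Icc 0 T, inner ℝ (indL2 T t) f = 0) : f = 0 := by
  rw [Lp.eq_zero_iff_ae_eq_zero]
  refine ae_eq_zero_of_forall_setIntegral_Iio ((Lp.memLp f).integrable (by norm_num)) fun v => ?_
  have h_inner := h ⟨max 0 (min v T), le_max_left _ _, max_le hT (min_le_right _ _)⟩
  rwa [indL2, L2.inner_indicatorConstLp_one, ← restrict_leb_Iio] at h_inner

theorem dense_span_indL2 {T : ℝ} (hT : 0 ≤ T) :
    Dense (Submodule.span ℝ (range fun t : Icc (0 : ℝ) T => indL2 T t) : Set (L2 T)) := by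
  rw [Submodule.dense_iff_topologicalClosure_eq_top, Submodule.topologicalClosure_eq_top_iff,
    Submodule.eq_bot_iff]
  intro f hf
  exact eq_zero_of_forall_inner_indL2 hT fun t =>
    (Submodule.mem_orthogonal _ _).1 hf _ (Submodule.subset_span (mem_range_self t))

theorem clm_ext_indL2 {T : ℝ} (hT : 0 ≤ T) {F : Type*} [NormedAddCommGroup F] [NormedSpace ℝ F]
    {A B : L2 T →L[ℝ] F} (h : ∀ t : Icc (0 : ℝ) T, A (indL2 T t) = B (indL2 T t)) : A = B :=
  ContinuousLinearMap.ext_on (dense_span_indL2 hT) (by rintro _ ⟨t, rfl⟩; exact h t)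

/-! ### The integrand space -/

section IntegrandSpace

variable {Ω : Type*} [MeasurableSpace Ω] {P : Measure Ω} {T : ℝ} {Y : SquareIntegrableProcess P T}
  {E : Type*} [NormedAddCommGroup E] [InnerProductSpace ℝ E] {v : Icc (0 : ℝ) T → E}

theorem stepInner_eq_inner_linearCombination (h : ∀ t s, covFun Y t s = inner ℝ (v t) (v s))
    (c d : StepFn Y) : stepInner Y c d =
      inner ℝ (Finsupp.linearCombination ℝ v c) (Finsupp.linearCombination ℝ v d) := by
  have h_sum (e : StepFn Y) :
      Finsupp.linearCombination ℝ v e = Finsupp.sum e fun t x => x • v t :=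
    Finsupp.linearCombination_apply ℝ e
  simp only [stepInner, h_sum, Finsupp.sum, sum_inner, inner_sum, inner_smul_left,
    inner_smul_right, h, Finset.mul_sum, RCLike.conj_to_real]
  rw [Finset.sum_comm]
  exact Finset.sum_congr rfl fun _ _ => Finset.sum_congr rfl fun _ _ => by ring

/-- The isometry `∑ c_t 1_t ↦ ∑ c_t v_t` on step functions, for vectors `v_t` whose Gram matrix is
the covariance function of `Y`. -/
def gramIsometry (h : ∀ t s, covFun Y t s = inner ℝ (v t) (v s)) : StepFn Y →ₗᵢ[ℝ] E where
  toLinearMap := Finsupp.linearCombination ℝ v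
  norm_map' c := by
    have h_inner : inner ℝ c c = inner ℝ (Finsupp.linearCombination ℝ v c) _ :=
      stepInner_eq_inner_linearCombination h c c
    rw [real_inner_self_eq_norm_sq, real_inner_self_eq_norm_sq] at h_inner
    exact ((sq_eq_sq₀ (norm_nonneg _) (norm_nonneg _)).1 h_inner).symm

variable [CompleteSpace E]

/-- The extension of `gramIsometry` to the integrand space of `Y`. -/
def lamIsometry (h : ∀ t s, covFun Y t s = inner ℝ (v t) (v s)) : Lam Y →ₗᵢ[ℝ] E where
  toLinearMap := (gramIsometry h).toContinuousLinearMap.fromCompletion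
  norm_map' x := by
    change ‖(gramIsometry h).toContinuousLinearMap.fromCompletion x‖ = ‖x‖
    refine UniformSpace.Completion.induction_on x (isClosed_eq (by fun_prop) continuous_norm)
      fun c => ?_
    rw [ContinuousLinearMap.fromCompletion_apply_coe, UniformSpace.Completion.norm_coe]
    exact (gramIsometry h).norm_map c

theorem lamIsometry_indLam (h : ∀ t s, covFun Y t s = inner ℝ (v t) (v s)) (t : Icc (0 : ℝ) T) :
    lamIsometry h (indLam Y t) = v t := by
  have h_coe : lamIsometry h (indLam Y t) = gramIsometry h (stepInd Y t) :=
    ContinuousLinearMap.fromCompletion_apply_coe _ _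
  rw [h_coe]
  exact (Finsupp.linearCombination_single ℝ 1 t).trans (one_smul ℝ _)

theorem lamIsometry_surjective (h : ∀ t s, covFun Y t s = inner ℝ (v t) (v s))
    (hv : Dense (Submodule.span ℝ (range v) : Set E)) : Function.Surjective (lamIsometry h) := by
  have h_span : Submodule.span ℝ (range v) ≤ LinearMap.range (lamIsometry h).toLinearMap := by
    rw [Submodule.span_le]
    rintro _ ⟨t, rfl⟩
    exact ⟨indLam Y t, lamIsometry_indLam h t⟩
  have h_dense : DenseRange (lamIsometry h) := hv.mono h_span
  rw [← range_eq_univ, ← h_dense.closure_range]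
  exact (lamIsometry h).isometry.isClosedEmbedding.isClosed_range.closure_eq.symm

theorem integrandSpaceEqL2_of_covFun (hT : 0 ≤ T) (S : L2 T ≃L[ℝ] L2 T)
    (h : ∀ t s : Icc (0 : ℝ) T, covFun Y t s = inner ℝ (S (indL2 T t)) (S (indL2 T s))) :
    IntegrandSpaceEqL2 Y := by
  have h_dense : Dense (Submodule.span ℝ
      (range fun t : Icc (0 : ℝ) T => S (indL2 T t)) : Set (L2 T)) := by
    have h_image := S.surjective.denseRange.dense_image S.continuous (dense_span_indL2 hT)
    rwa [← ContinuousLinearEquiv.coe_toLinearEquiv, ← LinearEquiv.coe_coe, ← Submodule.map_coe,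
      Submodule.map_span, ← range_comp] at h_image
  refine ⟨(LinearIsometryEquiv.ofSurjective _
    (lamIsometry_surjective h h_dense)).toContinuousLinearEquiv.trans S.symm, fun t => ?_⟩
  change S.symm (lamIsometry h (indLam Y t)) = _
  rw [lamIsometry_indLam, S.symm_apply_apply]

end IntegrandSpace

/-! ### The Wiener integral and the transfer principle -/

section Wiener

variable {Ω : Type*} [MeasurableSpace Ω] {P : Measure Ω} {T : ℝ}
  {Y W X : SquareIntegrableProcess P T}

/-- The abstract Wiener integral with respect to `Y` as a bounded operator on `L²[0, T]`. -/
def wienerCLM (h : IntegrandSpaceEqL2 Y) : L2 T →L[ℝ] Lp ℝ 2 P :=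
  (stepIsometry Y).toContinuousLinearMap.fromCompletion.comp
    (h.choose.symm : L2 T →L[ℝ] Lam Y)

theorem wienerIntegral_of_ae_eq (h : IntegrandSpaceEqL2 Y) {f : ℝ → ℝ} {F : L2 T}
    (hF : F =ᵐ[leb T] f) : wienerIntegral Y f = wienerCLM h F := by
  have hf : MemLp f 2 (leb T) := (memLp_congr_ae hF).1 (Lp.memLp F)
  obtain rfl : hf.toLp f = F := Lp.ext (hf.coeFn_toLp.trans hF.symm)
  rw [wienerIntegral, dif_pos ⟨h, hf⟩]
  rfl

theorem wienerIntegral_eq_wienerCLM (h : IntegrandSpaceEqL2 Y) {f : ℝ → ℝ}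
    (hf : MemLp f 2 (leb T)) : wienerIntegral Y f = wienerCLM h (hf.toLp f) :=
  wienerIntegral_of_ae_eq h hf.coeFn_toLp

theorem wienerCLM_indL2 (h : IntegrandSpaceEqL2 Y) (t : Icc (0 : ℝ) T) :
    wienerCLM h (indL2 T t) = Y.toL2 t := by
  rw [← chaosMap_indLam, ← h.choose_spec t]
  change chaosMap Y (h.choose.symm (h.choose (indLam Y t))) = _
  rw [ContinuousLinearEquiv.symm_apply_apply]

theorem inner_wienerCLM (hT : 0 ≤ T) (h : IntegrandSpaceEqL2 Y)
    (h_cov : ∀ t s : Icc (0 : ℝ) T, covFun Y t s = inner ℝ (indL2 T t) (indL2 T s)) (f g : L2 T) :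
    inner ℝ (wienerCLM h f) (wienerCLM h g) = inner ℝ f g := by
  have h_adjoint : (ContinuousLinearMap.adjoint (wienerCLM h)).comp (wienerCLM h) =
      ContinuousLinearMap.id ℝ (L2 T) := by
    refine clm_ext_indL2 hT fun s => ?_
    rw [← sub_eq_zero]
    refine eq_zero_of_forall_inner_indL2 hT fun t => ?_
    rw [inner_sub_right, ContinuousLinearMap.comp_apply, ContinuousLinearMap.adjoint_inner_right,
      wienerCLM_indL2, wienerCLM_indL2, inner_toL2, h_cov, ContinuousLinearMap.id_apply, sub_self]
  rw [← ContinuousLinearMap.adjoint_inner_right, ← ContinuousLinearMap.comp_apply, h_adjoint,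
    ContinuousLinearMap.id_apply]

section Transfer

variable {hW : IntegrandSpaceEqL2 W} {S : L2 T ≃L[ℝ] L2 T}

theorem integrandSpaceEqL2_of_toL2_eq (hT : 0 ≤ T)
    (h_cov : ∀ t s : Icc (0 : ℝ) T, covFun W t s = inner ℝ (indL2 T t) (indL2 T s))
    (hX : ∀ t : Icc (0 : ℝ) T, X.toL2 t = wienerCLM hW (S (indL2 T t))) :
    IntegrandSpaceEqL2 X :=
  integrandSpaceEqL2_of_covFun hT S fun t s => by
    rw [← inner_toL2, hX, hX, inner_wienerCLM hT hW h_cov]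

theorem wienerCLM_of_toL2_eq (hT : 0 ≤ T)
    (hX : ∀ t : Icc (0 : ℝ) T, X.toL2 t = wienerCLM hW (S (indL2 T t)))
    (hΛ : IntegrandSpaceEqL2 X) (f : L2 T) : wienerCLM hΛ f = wienerCLM hW (S f) := by
  have h_comp : wienerCLM hΛ = (wienerCLM hW).comp (S : L2 T →L[ℝ] L2 T) :=
    clm_ext_indL2 hT fun t => (wienerCLM_indL2 hΛ t).trans (hX t)
  rw [h_comp, ContinuousLinearMap.comp_apply, ContinuousLinearEquiv.coe_coe]

theorem wienerIntegral_eq_of_toL2_eq (hT : 0 ≤ T)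
    (hX : ∀ t : Icc (0 : ℝ) T, X.toL2 t = wienerCLM hW (S (indL2 T t)))
    (hΛ : IntegrandSpaceEqL2 X) {f g : ℝ → ℝ} (hf : MemLp f 2 (leb T))
    (hg : S (hf.toLp f) =ᵐ[leb T] g) : wienerIntegral X f = wienerIntegral W g := by
  rw [wienerIntegral_eq_wienerCLM hΛ hf, wienerIntegral_of_ae_eq hW hg,
    wienerCLM_of_toL2_eq hT hX]

theorem wienerIntegral_eq_symm_of_toL2_eq (hT : 0 ≤ T)
    (hX : ∀ t : Icc (0 : ℝ) T, X.toL2 t = wienerCLM hW (S (indL2 T t)))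
    (hΛ : IntegrandSpaceEqL2 X) {f g : ℝ → ℝ} (hf : MemLp f 2 (leb T))
    (hg : S.symm (hf.toLp f) =ᵐ[leb T] g) : wienerIntegral W f = wienerIntegral X g := by
  rw [wienerIntegral_eq_wienerCLM hW hf, wienerIntegral_of_ae_eq hΛ hg,
    wienerCLM_of_toL2_eq hT hX, S.apply_symm_apply]

end Transfer

theorem toL2_eq_wienerCLM_LstarEquiv {a b H : ℝ} (ha : a ≠ 0) (hH : H ∈ Ioo (1 / 2 : ℝ) 1)
    (hX : IsCCMFBm a b H W X) (hW : IntegrandSpaceEqL2 W) (t : Icc (0 : ℝ) T) :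
    X.toL2 t = wienerCLM hW (LstarEquiv ha b hH T (indL2 T t)) := by
  have hK : MemLp (KH H t) 2 (leb T) := memLp_KH hH t.2.2
  have h_Lstar : LstarEquiv ha b hH T (indL2 T t) = a • indL2 T t + b • hK.toLp (KH H t) := by
    refine Lp.ext ((LstarEquiv_indL2_ae_eq ha b hH t.2.2).trans ?_)
    rw [← toLp_ind, ← MemLp.toLp_const_smul, ← MemLp.toLp_const_smul, ← MemLp.toLp_add]
    exact (MemLp.coeFn_toLp _).symm
  rw [h_Lstar, map_add, map_smul, map_smul, wienerCLM_indL2, ← wienerIntegral_eq_wienerCLM hW hK]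
  refine Lp.ext ?_
  filter_upwards [(X.memLp t).coeFn_toLp, hX t,
    Lp.coeFn_add (a • W.toL2 t) (b • wienerIntegral W (KH H t)), Lp.coeFn_smul a (W.toL2 t),
    Lp.coeFn_smul b (wienerIntegral W (KH H t)), (W.memLp t).coeFn_toLp]
    with ω hX_toLp hXt h_add h_smul_W h_smul_K hW_toLp
  rw [SquareIntegrableProcess.toL2, hX_toLp, hXt, h_add, Pi.add_apply, h_smul_W, h_smul_K,
    Pi.smul_apply, Pi.smul_apply, SquareIntegrableProcess.toL2, hW_toLp, smul_eq_mul, smul_eq_mul]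

theorem covFun_brownianMotion [IsProbabilityMeasure P] (hW : IsBrownianMotion W)
    (t s : Icc (0 : ℝ) T) : covFun W t s = min (t : ℝ) s := by
  have h := covariance_eq_sub (W.memLp t) (W.memLp s)
  rw [hW.cov, hW.mean, zero_mul, sub_zero] at h
  exact h.symm

end Wiener

end CCMFBm

end

theorem mainTheorem2_general {Ω : Type*} [MeasurableSpace Ω] (P : Measure Ω) (T : ℝ) (hT : 0 < T)
    (a b H : ℝ) (ha : a ≠ 0) (hH : H ∈ Ioo (1 / 2 : ℝ) 1) (W X : CCMFBm.SquareIntegrableProcess P T)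
    (hW : ∀ t s, CCMFBm.covFun W t s = min (t : ℝ) s) (hX : CCMFBm.IsCCMFBm a b H W X) :
    CCMFBm.IntegrandSpaceEqL2 W ∧ CCMFBm.IntegrandSpaceEqL2 X ∧
    (∀ t ∈ Icc 0 T, ∀ s ∈ Icc 0 T,
      Summable fun k : ℕ => CCMFBm.LinvTerm a b H t s (k + 1)) ∧
    (∀ s ∈ Icc 0 T, BoundedVariationOn (fun t => CCMFBm.Linv a b H t s) (Icc 0 T)) ∧
    ∃ Ls : CCMFBm.L2 T ≃L[ℝ] CCMFBm.L2 T,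
      (∀ t ∈ Icc 0 T, Ls (CCMFBm.indL2 T t) =ᵐ[CCMFBm.leb T] CCMFBm.Lker a b H t) ∧
      (∀ t ∈ Icc 0 T, Ls.symm (CCMFBm.indL2 T t) =ᵐ[CCMFBm.leb T] CCMFBm.Linv a b H t) ∧
      ∀ (f : ℝ → ℝ) (hf : MemLp f 2 (CCMFBm.leb T)),
        (∀ᵐ t ∂CCMFBm.leb T,
          IntervalIntegrable (fun s => f s * deriv (fun u => CCMFBm.KH H u t) s)
            volume t T) ∧
        (∀ᵐ t ∂CCMFBm.leb T,
          (CCMFBm.stieltjes (fun s => CCMFBm.Linv a b H s t) t T).IntegrableOn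
            (fun s => f s - f t) (Icc t T)) ∧
        Ls (hf.toLp f) =ᵐ[CCMFBm.leb T] CCMFBm.Lstar a b H T f ∧
        Ls.symm (hf.toLp f) =ᵐ[CCMFBm.leb T] CCMFBm.LstarInv a b H T f ∧
        CCMFBm.wienerIntegral X f = CCMFBm.wienerIntegral W (CCMFBm.Lstar a b H T f) ∧
        CCMFBm.wienerIntegral W f = CCMFBm.wienerIntegral X (CCMFBm.LstarInv a b H T f) := by
  have h_cov (t s : Icc (0 : ℝ) T) :
      CCMFBm.covFun W t s = inner ℝ (CCMFBm.indL2 T t) (CCMFBm.indL2 T s) :=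
    (hW t s).trans (CCMFBm.inner_indL2 t.2 s.2).symm
  have hΛW : CCMFBm.IntegrandSpaceEqL2 W :=
    CCMFBm.integrandSpaceEqL2_of_covFun hT.le (ContinuousLinearEquiv.refl ℝ _) h_cov
  have hX_toL2 := CCMFBm.toL2_eq_wienerCLM_LstarEquiv ha hH hX hΛW
  have hΛX : CCMFBm.IntegrandSpaceEqL2 X := CCMFBm.integrandSpaceEqL2_of_toL2_eq hT.le h_cov hX_toL2
  refine ⟨hΛW, hΛX, fun t _ s hs => CCMFBm.summable_LinvTerm a b hH.1 hs.1 t,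
    fun s hs => (CCMFBm.boundedVariationOn_Linv a b hH.1 hs.1 hT).mono Icc_subset_Iic_self,
    CCMFBm.LstarEquiv ha b hH T, fun t ht => CCMFBm.LstarEquiv_indL2_ae_eq ha b hH ht.2,
    fun t ht => CCMFBm.LstarEquiv_symm_indL2_ae_eq ha b hH ht.2, fun f hf => ?_⟩
  have h_Lstar := CCMFBm.LstarEquiv_toLp_ae_eq ha b hH hf
  have h_LstarInv := CCMFBm.LstarEquiv_symm_toLp_ae_eq ha b hH hf
  exact ⟨CCMFBm.ae_intervalIntegrable_mul_deriv_KH hH hf,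
    CCMFBm.ae_integrableOn_stieltjes_Linv a b hH hf, h_Lstar, h_LstarInv,
    CCMFBm.wienerIntegral_eq_of_toL2_eq hT.le hX_toL2 hΛX hf h_Lstar,
    CCMFBm.wienerIntegral_eq_symm_of_toL2_eq hT.le hX_toL2 hΛX hf h_LstarInv⟩

theorem mainTheorem2 {Ω : Type*} [MeasurableSpace Ω] (P : MeasureTheory.Measure Ω)
    [MeasureTheory.IsProbabilityMeasure P] (T : ℝ) (hT : 0 < T)
    (a b H : ℝ) (hab : a * b ≠ 0) (hH : H ∈ Set.Ioo (1 / 2 : ℝ) 1)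
    (W X : CCMFBm.SquareIntegrableProcess P T)
    (hW : CCMFBm.IsBrownianMotion W) (hX : CCMFBm.IsCCMFBm a b H W X) :
    -- the integrand spaces of `W` and of `X` are `L²[0, T]`
    CCMFBm.IntegrandSpaceEqL2 W ∧ CCMFBm.IntegrandSpaceEqL2 X ∧
    -- the series of `L⁻¹(t,s)` converges, and `L⁻¹(·,s)` is of bounded variation
    (∀ t ∈ Set.Icc 0 T, ∀ s ∈ Set.Icc 0 T,
      Summable fun k : ℕ => CCMFBm.LinvTerm a b H t s (k + 1)) ∧
    (∀ s ∈ Set.Icc 0 T, BoundedVariationOn (fun t => CCMFBm.Linv a b H t s) (Set.Icc 0 T)) ∧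
    -- `L^*`, the linear extension of `1_t ↦ L(t,·)`, is an isomorphism of `L²[0, T]`
    ∃ Ls : CCMFBm.L2 T ≃L[ℝ] CCMFBm.L2 T,
      (∀ t ∈ Set.Icc 0 T, Ls (CCMFBm.indL2 T t) =ᵐ[CCMFBm.leb T] CCMFBm.Lker a b H t) ∧
      (∀ t ∈ Set.Icc 0 T, Ls.symm (CCMFBm.indL2 T t) =ᵐ[CCMFBm.leb T] CCMFBm.Linv a b H t) ∧
      ∀ (f : ℝ → ℝ) (hf : MeasureTheory.MemLp f 2 (CCMFBm.leb T)),
        -- the integrals in the two formulas converge absolutely for almost every `t`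
        (∀ᵐ t ∂CCMFBm.leb T,
          IntervalIntegrable (fun s => f s * deriv (fun u => CCMFBm.KH H u t) s)
            MeasureTheory.volume t T) ∧
        (∀ᵐ t ∂CCMFBm.leb T,
          (CCMFBm.stieltjes (fun s => CCMFBm.Linv a b H s t) t T).IntegrableOn
            (fun s => f s - f t) (Set.Icc t T)) ∧
        -- the formulas give `L^*` and its inverse
        Ls (hf.toLp f) =ᵐ[CCMFBm.leb T] CCMFBm.Lstar a b H T f ∧
        Ls.symm (hf.toLp f) =ᵐ[CCMFBm.leb T] CCMFBm.LstarInv a b H T f ∧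
        -- the transfer principle
        CCMFBm.wienerIntegral X f = CCMFBm.wienerIntegral W (CCMFBm.Lstar a b H T f) ∧
        CCMFBm.wienerIntegral W f = CCMFBm.wienerIntegral X (CCMFBm.LstarInv a b H T f) :=
  mainTheorem2_general P T hT a b H (left_ne_zero_of_mul hab) hH W X
    (CCMFBm.covFun_brownianMotion hW) hX
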